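/- Let $X$ be a complex Banach space, $0<\alpha<1$, and let $A:D(A)\subseteq X\to X$ be a sectorial operator of type $(M,\theta,\alpha,\mu)$: $A$ is a closed linear operator, $0<\theta<\pi/2$, $M>0$, $\mu\in\mathbb R$, and for every $\lambda\in\mathbb C$ with $\lambda^\alpha\notin\mu+S_\theta$ (principal power), where $S_\theta=\{z\in\mathbb C: |\arg(-z)|<\theta\}$ with the vertex $0$ included, the resolvent $R(\lambda^\alpha,A)=(\lambda^\alpha I-A)^{-1}$ exists as a bounded operator and $\|R(\lambda^\alpha,A)\|\le M/|\lambda^\alpha-\mu|$. Call a Hankel path $c$ with parameters $r>0$ and $\delta\in(\pi/2,\pi)$ (from $\infty e^{-i\delta}$ along a ray to $re^{-i\delta}$, counterclockwise along the arc $|\lambda|=r$, $|\arg\lambda|\le\delta$, to $re^{i\delta}$, and along a ray to $\infty e^{i\delta}$) admissible if $\lambda^\alpha\notin\mu+S_\theta$ for all $\lambda$ with $|\lambda|\ge r$ and $|\arg\lambda|\le\delta$. For such a path put $S_\alpha(0)=I$ and $$S_\alpha(t)=\frac1{2\pi i}\int_c e^{\lambda t}\lambda^{\alpha-1}R(\lambda^\alpha,A)\,d\lambda,\qquad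 t>0 .$$ Then admissible paths exist, and for every admissible path, all real $t_i<t$ and every $y_i\in X$, writing $u(s)=S_\alpha(s-t_i)y_i$: the function $u$ is differentiable on $(t_i,\infty)$, $u(t)\in D(A)$, and $${}_{t_i}D_t^\alpha\,S_\alpha(t-t_i)y_i=A\,S_\alpha(t-t_i)y_i ,$$ where the Caputo derivative based at $t_i$ is understood as follows. 1. If $y_i\in D(A)$, it is the absolutely convergent integral ${}_{t_i}D_t^\alpha u(t)=\frac1{\Gamma(1-\alpha)}\int_{t_i}^t(t-s)^{-\alpha}u'(s)\,ds$ (the absolute convergence is part of the claim). 2. If $y_i\in\overline{D(A)}$ (so for every $y_i\in X$ if $A$ is densely defined), it is the same integral as an improper integral at $t_i$, that is, $\lim_{b\downarrow t_i}\frac1{\Gamma(1-\alpha)}\int_{b}^t(t-s)^{-\alpha}u'(s)\,ds$, where the integrals over $[b,t]$ converge absolutely and the limit exists in norm. 3. For every $y_i\in X$, it is the regularized Caputo derivative $\frac{d}{dt}\Big[\frac1{\Gamma(1-\alpha)}\int_{t_i}^t(t-s)^{-\alpha}\big(u(s)-u(t_i)\big)\,ds\Big]$, where these integrals converge absolutely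 and the derivative exists in norm. -/

import Mathlib

open scoped Topology

namespace FracSectorial

variable {X : Type*} [NormedAddCommGroup X] [NormedSpace ℂ X]

/-- `R` is the (bounded, everywhere defined, two-sided) inverse of `z I - A`, where `A` is a
possibly unbounded operator with domain `A.domain`. -/
def IsResolventAt (A : X →ₗ.[ℂ] X) (z : ℂ) (R : X →L[ℂ] X) : Prop :=
  (∀ x : X, ∃ h : R x ∈ A.domain, z • R x - A ⟨R x, h⟩ = x) ∧
    ∀ x : A.domain, R (z • (x : X) - A x) = x

/-- The resolvent set of `A`. -/
def resolventSet (A : X →ₗ.[ℂ] X) : Set ℂ :=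
  {z | ∃ R : X →L[ℂ] X, IsResolventAt A z R}

open Classical in
/-- The resolvent `R(z, A) = (z I - A)⁻¹` (with value `0` off the resolvent set). -/
noncomputable def resolventOp (A : X →ₗ.[ℂ] X) (z : ℂ) : X →L[ℂ] X :=
  if h : ∃ R : X →L[ℂ] X, IsResolventAt A z R then h.choose else 0

/-- The sector `S_θ = {z : |arg (-z)| < θ}` around the negative real axis.
Since `Complex.arg 0 = 0`, the vertex `0` belongs to it when `0 < θ`. -/
def sector (θ : ℝ) : Set ℂ := {z | |Complex.arg (-z)| < θ}

/-- Sectorial operators of type `(M, θ, α, μ)`: `A` is closed, and the `α`-resolvent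
`(λ ^ α - A)⁻¹` exists, with norm at most `M / |λ ^ α - μ|`, whenever `λ ^ α` (principal power)
lies outside `μ + S_θ`. -/
structure IsSectorial (A : X →ₗ.[ℂ] X) (M θ α μ : ℝ) : Prop where
  closed : A.IsClosed
  theta_pos : 0 < θ
  theta_lt : θ < Real.pi / 2
  M_pos : 0 < M
  mem_resolventSet : ∀ l : ℂ, l ^ (α : ℂ) - (μ : ℂ) ∉ sector θ →
    l ^ (α : ℂ) ∈ resolventSet A
  norm_resolventOp_le : ∀ l : ℂ, l ^ (α : ℂ) - (μ : ℂ) ∉ sector θ →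
    ‖resolventOp A (l ^ (α : ℂ))‖ ≤ M / ‖l ^ (α : ℂ) - (μ : ℂ)‖

/-- The parameters `r`, `δ` of an admissible Hankel path: the path consists of the rays
`arg λ = ± δ`, `|λ| ≥ r`, and the arc `|λ| = r`, `|arg λ| ≤ δ`, with `π / 2 < δ < π`, and `λ ^ α`
stays outside `μ + S_θ` on the path and to the right of it. -/
structure IsHankelPath (θ α μ r δ : ℝ) : Prop where
  r_pos : 0 < r
  lt_delta : Real.pi / 2 < δ
  delta_lt : δ < Real.pi
  avoids : ∀ l : ℂ, r ≤ ‖l‖ → |Complex.arg l| ≤ δ → l ^ (α : ℂ) - (μ : ℂ) ∉ sector θ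

/-- The integral `∫ F(λ) dλ` along the Hankel path with parameters `r`, `δ`, which runs from
`∞ e^{-iδ}` along the lower ray to `r e^{-iδ}`, counterclockwise along the arc to `r e^{iδ}`, and
along the upper ray to `∞ e^{iδ}`. -/
noncomputable def hankelIntegral {E : Type*} [NormedAddCommGroup E] [NormedSpace ℂ E]
    (r δ : ℝ) (F : ℂ → E) : E :=
  (∫ φ in (-δ)..δ,
      (Complex.I * ((r : ℂ) * Complex.exp (φ * Complex.I))) •
        F ((r : ℂ) * Complex.exp (φ * Complex.I)))
    + (∫ ρ in Set.Ioi r,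
      Complex.exp (δ * Complex.I) • F ((ρ : ℂ) * Complex.exp (δ * Complex.I)))
    - (∫ ρ in Set.Ioi r,
      Complex.exp (-(δ * Complex.I)) • F ((ρ : ℂ) * Complex.exp (-(δ * Complex.I))))

/-- The operator `S_α(t) = (1 / 2πi) ∫_c e^{λ t} λ^{α - 1} R(λ^α, A) dλ` for `t > 0`, where `c` is
the Hankel path with parameters `r`, `δ`, and `S_α(0) = I`. -/
noncomputable def solOp (A : X →ₗ.[ℂ] X) (α r δ t : ℝ) : X →L[ℂ] X :=
  if t = 0 then ContinuousLinearMap.id ℂ X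
  else (2 * (Real.pi : ℂ) * Complex.I)⁻¹ •
    hankelIntegral r δ (fun l : ℂ =>
      (Complex.exp (l * t) * l ^ ((α : ℂ) - 1)) • resolventOp A (l ^ (α : ℂ)))

/-- The Caputo derivative of order `0 < α < 1` based at `a`,
`(1 / Γ(1 - α)) ∫_a^t (t - s)^{-α} f'(s) ds`. -/
noncomputable def caputoDeriv (α a : ℝ) (f : ℝ → X) (t : ℝ) : X :=
  (Real.Gamma (1 - α))⁻¹ • ∫ s in a..t, (t - s) ^ (-α) • deriv f s

/-- The Caputo derivative of order `0 < α < 1` based at `a` exists at `t` and equals `v`, the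
defining integral being absolutely convergent. -/
def HasCaputoDeriv (α a : ℝ) (f : ℝ → X) (t : ℝ) (v : X) : Prop :=
  (∀ s ∈ Set.Ioo a t, DifferentiableAt ℝ f s) ∧
    IntervalIntegrable (fun s => (t - s) ^ (-α) • deriv f s) MeasureTheory.volume a t ∧
    caputoDeriv α a f t = v

/-- The same, with the defining integral understood as an improper integral at the base point:
`(1 / Γ(1 - α)) ∫_b^t (t - s)^{-α} f'(s) ds` tends to `v` as `b ↓ a`. -/
def HasImproperCaputoDeriv (α a : ℝ) (f : ℝ → X) (t : ℝ) (v : X) : Prop :=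
  (∀ s ∈ Set.Ioo a t, DifferentiableAt ℝ f s) ∧
    (∀ b ∈ Set.Ioo a t,
      IntervalIntegrable (fun s => (t - s) ^ (-α) • deriv f s) MeasureTheory.volume b t) ∧
    Filter.Tendsto
      (fun b => (Real.Gamma (1 - α))⁻¹ • ∫ s in b..t, (t - s) ^ (-α) • deriv f s)
      (𝓝[>] a) (𝓝 v)

/-- The regularized Caputo derivative of order `0 < α < 1` based at `a`, which makes sense also
when `f'` is not integrable at `a`:
`d/dt [(1 / Γ(1 - α)) ∫_a^t (t - s)^{-α} (f(s) - f(a)) ds] = v`. -/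
def HasRegularizedCaputoDeriv (α a : ℝ) (f : ℝ → X) (t : ℝ) (v : X) : Prop :=
  (∀ τ, a < τ →
    IntervalIntegrable (fun s => (τ - s) ^ (-α) • (f s - f a)) MeasureTheory.volume a τ) ∧
  HasDerivAt
    (fun τ => (Real.Gamma (1 - α))⁻¹ • ∫ s in a..τ, (τ - s) ^ (-α) • (f s - f a)) v t

end FracSectorial

/-!
The proof writes every object as an integral `∫ e^{λ t} F(λ) dλ` along the Hankel path, where `F` is
holomorphic on the region `|λ| ≥ r`, `|arg λ| ≤ δ` to the right of the path, with a power bound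
`F = O(|λ| ^ (-β))`.  Three facts about such integrals carry the argument.

* By Cauchy's theorem in the variable `log λ` the radius of the path can be enlarged
  (`hankelIntegral_eq_of_le`).  Hence the integral of a function that decays faster than `1 / |λ|`
  vanishes (`hankelIntegral_eq_zero`), and the radius `max r (1 / t)` gives the bound
  `O(t ^ (β - 1))` as `t → 0` (`exists_norm_hankelIntegral_exp_le`).
* For fixed `t > 0` the integrand decays exponentially along the path, so that one may differentiate
  under the integral sign (`hasDerivAt_hankelIntegral_exp_smul`).
* Convolution with `s ^ (-α)` multiplies `F` by `Γ(1 - α) λ ^ (α - 1)` if `F` decays faster than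
  `1 / |λ|` (`integral_sub_rpow_smul_hankelIntegral`).  Indeed
  `∫₀^τ (τ - s) ^ (-α) e^{λ s} ds - Γ(1 - α) e^{λ τ} λ ^ (α - 1)` is bounded on the whole region,
  so that the integral of its product with `F` vanishes.

Since `∫ e^{λ t} λ⁻¹ dλ = 2πi`, one has `S_α(t) y - y = (2πi)⁻¹ ∫ e^{λ t} λ⁻¹ A R(λ ^ α, A) y dλ`
(`solOp_eq_add_symbolOp`).  For `y` in the domain of `A` the integrand is
`O(|λ| ^ (-1 - α))`, so the third fact applies: the convolution of `S_α(·) y - y` with `s ^ (-α)` is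
`Γ(1 - α) (2πi)⁻¹ ∫ e^{λ t} λ ^ (α - 2) A R(λ ^ α, A) y dλ`.  Applying an injective resolvent
extends this to every `y` (`integral_sub_rpow_smul_orbitSub`).  The derivative of the right-hand
side is `Γ(1 - α) A S_α(t) y`, which is the regularized Caputo equation.

The other two forms follow by real analysis (`tendsto_integral_sub_rpow_smul_deriv`).  Put
`v(s) = S_α(s) y - y`; then `s v'(s)` is bounded for every `y`.  Comparing the derivative of the
convolution, computed after the scaling `s = t x`, with an integration by parts shows that
`∫_b^t (t - s) ^ (-α) v'(s) ds` tends to `Γ(1 - α) A S_α(t) y` as soon as `v(b) → 0`, which holds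
for `y` in the closure of the domain.  On the domain itself `v'(s) = O(s ^ (α - 1))`, so that the
integral converges absolutely.
-/

open scoped Topology

namespace FracSectorial

/-! ### The resolvent identity -/

section Resolvent
variable {X : Type*} [NormedAddCommGroup X] [NormedSpace ℂ X] {A : X →ₗ.[ℂ] X}

theorem isResolventAt_resolventOp {z : ℂ} (hz : z ∈ resolventSet A) :
    IsResolventAt A z (resolventOp A z) := by
  have h : ∃ R : X →L[ℂ] X, IsResolventAt A z R := hz
  rw [resolventOp, dif_pos h]
  exact h.choose_spec

theorem resolventOp_mem {z : ℂ} (hz : z ∈ resolventSet A) (x : X) :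
    resolventOp A z x ∈ A.domain :=
  ((isResolventAt_resolventOp hz).1 x).1

theorem apply_resolventOp {z : ℂ} (hz : z ∈ resolventSet A) (x : X) :
    A ⟨resolventOp A z x, resolventOp_mem hz x⟩ = z • resolventOp A z x - x := by
  obtain ⟨h, h'⟩ := (isResolventAt_resolventOp hz).1 x
  rw [eq_sub_iff_add_eq, ← eq_sub_iff_add_eq', h']

/-- On the domain, `A` commutes with its resolvent. -/
theorem smul_resolventOp_sub {z : ℂ} (hz : z ∈ resolventSet A) (x : A.domain) :
    z • resolventOp A z x - x = resolventOp A z (A x) := by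
  have h := (isResolventAt_resolventOp hz).2 x
  rw [map_sub, map_smul] at h
  rw [sub_eq_iff_eq_add, ← sub_eq_iff_eq_add', h]

theorem resolventOp_sub {z w : ℂ} (hz : z ∈ resolventSet A) (hw : w ∈ resolventSet A) :
    resolventOp A z - resolventOp A w = (w - z) • (resolventOp A z * resolventOp A w) := by
  ext x
  have h := (isResolventAt_resolventOp hz).2 ⟨resolventOp A w x, resolventOp_mem hw x⟩
  rw [apply_resolventOp hw] at h
  have h2 : z • resolventOp A w x - (w • resolventOp A w x - x)
      = x - (w - z) • resolventOp A w x := by rw [sub_smul]; abel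
  simp only [h2, map_sub, map_smul] at h
  simp only [sub_apply, smul_apply, mul_apply_eq_comp]
  exact sub_eq_iff_eq_add'.2 (sub_eq_iff_eq_add.1 h)

theorem resolventOp_mul_comm {z w : ℂ} (hz : z ∈ resolventSet A) (hw : w ∈ resolventSet A) :
    resolventOp A z * resolventOp A w = resolventOp A w * resolventOp A z := by
  rcases eq_or_ne z w with rfl | hne
  · rfl
  · have h1 := resolventOp_sub hz hw
    have h2 := resolventOp_sub hw hz
    have h3 : (w - z) • (resolventOp A z * resolventOp A w)
        = (w - z) • (resolventOp A w * resolventOp A z) := by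
      rw [← h1, ← neg_sub, h2, ← neg_smul, neg_sub]
    exact smul_right_injective _ (sub_ne_zero.2 hne.symm) h3

theorem resolventOp_injective {z : ℂ} (hz : z ∈ resolventSet A) :
    Function.Injective (resolventOp A z) := by
  rw [injective_iff_map_eq_zero]
  intro x hx
  have h := apply_resolventOp hz x
  have h0 : (⟨resolventOp A z x, resolventOp_mem hz x⟩ : A.domain) = 0 := Subtype.ext hx
  rw [h0, hx] at h
  simpa using h.symm

/-- A family of operators satisfying the resolvent identity along a differentiable function `p`
is differentiable as soon as it is locally bounded. -/
theorem differentiableOn_of_resolvent_identity {B : Type*} [NormedRing B] [NormedAlgebra ℂ B]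
    {s : Set ℂ} {G : ℂ → B} {p : ℂ → ℂ} {C : ℝ}
    (hp : DifferentiableOn ℂ p s) (hG : ∀ l ∈ s, ‖G l‖ ≤ C)
    (h : ∀ l ∈ s, ∀ w ∈ s, G l - G w = (p w - p l) • (G l * G w)) :
    DifferentiableOn ℂ G s := by
  intro w hw
  have hC : 0 ≤ C := (norm_nonneg _).trans (hG w hw)
  have hcont : ContinuousWithinAt G s w := by
    rw [ContinuousWithinAt, tendsto_iff_norm_sub_tendsto_zero]
    have h1 : Filter.Tendsto (fun l => ‖p w - p l‖ * (C * C)) (𝓝[s] w) (𝓝 0) := by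
      have := ((continuousWithinAt_const (b := p w)).sub
        (hp.continuousOn w hw)).norm.tendsto.mul_const (C * C)
      simpa using this
    refine squeeze_zero' (Filter.Eventually.of_forall fun _ => norm_nonneg _) ?_ h1
    filter_upwards [self_mem_nhdsWithin] with l hl
    rw [h l hl w hw, norm_smul]
    gcongr
    exact (norm_mul_le _ _).trans (mul_le_mul (hG l hl) (hG w hw) (norm_nonneg _) hC)
  obtain ⟨p', hp'⟩ : ∃ p', HasDerivWithinAt p p' s w := ⟨_, (hp w hw).hasDerivWithinAt⟩
  have key : HasDerivWithinAt G ((-p') • (G w * G w)) s w := by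
    rw [hasDerivWithinAt_iff_tendsto_slope] at hp' ⊢
    have h2 : Filter.Tendsto (fun l => (-slope p w l) • (G l * G w)) (𝓝[s \ {w}] w)
        (𝓝 ((-p') • (G w * G w))) :=
      hp'.neg.smul ((hcont.mono Set.sdiff_subset).tendsto.mul_const _)
    refine h2.congr' ?_
    filter_upwards [self_mem_nhdsWithin] with l hl
    rw [slope_def_module, slope_def_module, h l hl.1 w hw, smul_smul]
    congr 1
    simp only [smul_eq_mul]
    ring
  exact key.differentiableWithinAt

end Resolvent

/-! ### Hankel paths and Cauchy's theorem -/

section Contour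
open Complex MeasureTheory Set
variable {E : Type*} [NormedAddCommGroup E] [NormedSpace ℂ E] {r δ : ℝ}

/-- The closed region `|λ| ≥ r`, `|arg λ| ≤ δ` on and to the right of a Hankel path. -/
def hankelRegion (r δ : ℝ) : Set ℂ := {l | r ≤ ‖l‖ ∧ |arg l| ≤ δ}

theorem norm_ofReal_mul_exp {ρ : ℝ} (hρ : 0 ≤ ρ) (φ : ℝ) : ‖(ρ : ℂ) * exp (φ * I)‖ = ρ := by
  rw [norm_mul, norm_exp_ofReal_mul_I, mul_one, norm_real, Real.norm_of_nonneg hρ]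

theorem re_ofReal_mul_exp (ρ φ : ℝ) : ((ρ : ℂ) * exp (φ * I)).re = ρ * Real.cos φ := by
  rw [re_ofReal_mul, exp_ofReal_mul_I_re]

theorem mem_hankelRegion (hr : 0 < r) (hδ : δ < Real.pi) {ρ φ : ℝ} (hρ : r ≤ ρ) (hφ : |φ| ≤ δ) :
    (ρ : ℂ) * exp (φ * I) ∈ hankelRegion r δ := by
  have h := abs_le.1 hφ
  refine ⟨by rwa [norm_ofReal_mul_exp (hr.le.trans hρ)], ?_⟩
  rwa [exp_mul_I, arg_mul_cos_add_sin_mul_I (hr.trans_le hρ) ⟨by linarith, by linarith⟩]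

theorem ne_zero_of_mem_hankelRegion (hr : 0 < r) {l : ℂ} (hl : l ∈ hankelRegion r δ) : l ≠ 0 :=
  norm_pos_iff.1 (hr.trans_le hl.1)

theorem mem_slitPlane_of_mem_hankelRegion (hr : 0 < r) (hδ : δ < Real.pi) {l : ℂ}
    (hl : l ∈ hankelRegion r δ) : l ∈ slitPlane := by
  refine mem_slitPlane_iff_arg.2 ⟨fun h => ?_, ne_zero_of_mem_hankelRegion hr hl⟩
  have := (le_abs_self _).trans hl.2
  linarith

theorem hankelIntegral_congr (hr : 0 < r) (hδ0 : 0 < δ) (hδ : δ < Real.pi) {F G : ℂ → E}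
    (h : ∀ l ∈ hankelRegion r δ, F l = G l) : hankelIntegral r δ F = hankelIntegral r δ G := by
  unfold hankelIntegral
  congr 1
  · congr 1
    · refine intervalIntegral.integral_congr fun φ hφ => ?_
      rw [uIcc_of_le (by linarith)] at hφ
      simp only [h _ (mem_hankelRegion hr hδ le_rfl (abs_le.2 hφ))]
    · refine setIntegral_congr_fun measurableSet_Ioi fun ρ hρ => ?_
      simp only [h _ (mem_hankelRegion hr hδ (le_of_lt hρ) (abs_of_pos hδ0).le)]
  · refine setIntegral_congr_fun measurableSet_Ioi fun ρ hρ => ?_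
    have := h _ (mem_hankelRegion hr hδ (φ := -δ) (le_of_lt hρ) (by rw [abs_neg, abs_of_pos hδ0]))
    rw [ofReal_neg, neg_mul] at this
    simp only [this]

theorem norm_hankelIntegral_le (hr : 0 < r) (hδ0 : 0 < δ) {F : ℂ → E} {m : ℝ} {B : ℝ → ℝ}
    (harc : ∀ φ : ℝ, |φ| ≤ δ → ‖F ((r : ℂ) * exp (φ * I))‖ ≤ m)
    (hray : ∀ ρ : ℝ, r < ρ → ‖F ((ρ : ℂ) * exp (δ * I))‖ ≤ B ρ)
    (hray' : ∀ ρ : ℝ, r < ρ → ‖F ((ρ : ℂ) * exp ((-δ : ℝ) * I))‖ ≤ B ρ)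
    (hB : IntegrableOn B (Ioi r)) :
    ‖hankelIntegral r δ F‖ ≤ 2 * δ * (r * m) + 2 * ∫ ρ in Ioi r, B ρ := by
  have h1 : ‖∫ φ in (-δ)..δ, (I * ((r : ℂ) * exp (φ * I))) • F ((r : ℂ) * exp (φ * I))‖
      ≤ (r * m) * |δ - -δ| := by
    refine intervalIntegral.norm_integral_le_of_norm_le_const fun φ hφ => ?_
    rw [uIoc_of_le (by linarith)] at hφ
    rw [norm_smul, norm_mul, norm_I, one_mul, norm_ofReal_mul_exp hr.le]
    gcongr
    exact harc φ (abs_le.2 ⟨hφ.1.le, hφ.2⟩)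
  have h2 : ‖∫ ρ in Ioi r, exp (δ * I) • F ((ρ : ℂ) * exp (δ * I))‖ ≤ ∫ ρ in Ioi r, B ρ := by
    refine norm_integral_le_of_norm_le hB ?_
    refine (ae_restrict_iff' measurableSet_Ioi).2 (Filter.Eventually.of_forall fun ρ hρ => ?_)
    rw [norm_smul, norm_exp_ofReal_mul_I, one_mul]
    exact hray ρ hρ
  have h3 : ‖∫ ρ in Ioi r, exp (-(δ * I)) • F ((ρ : ℂ) * exp (-(δ * I)))‖
      ≤ ∫ ρ in Ioi r, B ρ := by
    refine norm_integral_le_of_norm_le hB ?_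
    refine (ae_restrict_iff' measurableSet_Ioi).2 (Filter.Eventually.of_forall fun ρ hρ => ?_)
    rw [← neg_mul, ← ofReal_neg, norm_smul, norm_exp_ofReal_mul_I, one_mul]
    exact hray' ρ hρ
  have h4 : |δ - -δ| = 2 * δ := by rw [abs_of_pos (by linarith)]; ring
  rw [h4] at h1
  unfold hankelIntegral
  refine (norm_sub_le _ _).trans ?_
  refine (add_le_add (norm_add_le _ _) le_rfl).trans ?_
  linarith

/-- The substitution `ρ = exp x` on a segment of a ray. -/
theorem integral_exp_smul_ray {R φ : ℝ} (hr : 0 < r) (hrR : r ≤ R) {F : ℂ → E}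
    (hF : ContinuousOn (fun ρ : ℝ => F ((ρ : ℂ) * exp (φ * I))) (Icc r R)) :
    ∫ x in Real.log r..Real.log R, exp (x + φ * I) • F (exp (x + φ * I))
      = ∫ ρ in r..R, exp (φ * I) • F ((ρ : ℂ) * exp (φ * I)) := by
  have hR : 0 < R := hr.trans_le hrR
  have hlog : Real.log r ≤ Real.log R := Real.log_le_log hr hrR
  have h := intervalIntegral.integral_deriv_smul_comp' (a := Real.log r) (b := Real.log R)
    (f := Real.exp) (f' := Real.exp) (g := fun ρ : ℝ => exp (φ * I) • F ((ρ : ℂ) * exp (φ * I)))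
    (fun x _ => Real.hasDerivAt_exp x) Real.continuous_exp.continuousOn ?_
  · rw [Real.exp_log hr, Real.exp_log hR] at h
    rw [← h]
    refine intervalIntegral.integral_congr fun x _ => ?_
    simp only [Function.comp, exp_add, ofReal_exp]
    rw [← coe_smul, smul_smul, ofReal_exp]
  · refine (continuousOn_const.smul hF).mono ?_
    rintro _ ⟨x, hx, rfl⟩
    rw [uIcc_of_le hlog] at hx
    exact ⟨(Real.log_le_iff_le_exp hr).1 hx.1, (Real.le_log_iff_exp_le hR).1 hx.2⟩

/-- Cauchy's theorem: the arc of a Hankel path may be pushed outwards. -/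
theorem hankelIntegral_eq_of_le (hr : 0 < r) (hδ0 : 0 < δ) (hδ : δ < Real.pi) {R : ℝ}
    (hrR : r ≤ R) {F : ℂ → E} (hF : DifferentiableOn ℂ F (hankelRegion r δ))
    (h1 : IntegrableOn (fun ρ : ℝ => F ((ρ : ℂ) * exp (δ * I))) (Ioi r))
    (h2 : IntegrableOn (fun ρ : ℝ => F ((ρ : ℂ) * exp ((-δ : ℝ) * I))) (Ioi r)) :
    hankelIntegral r δ F = hankelIntegral R δ F := by
  have hR : 0 < R := hr.trans_le hrR
  have hlog : Real.log r ≤ Real.log R := Real.log_le_log hr hrR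
  have hray : ∀ φ : ℝ, |φ| ≤ δ →
      ContinuousOn (fun ρ : ℝ => F ((ρ : ℂ) * exp (φ * I))) (Icc r R) := by
    intro φ hφ
    refine hF.continuousOn.comp (by fun_prop) fun ρ hρ => mem_hankelRegion hr hδ hρ.1 hφ
  have hexp : ∀ w : ℂ, exp w = ((Real.exp w.re : ℝ) : ℂ) * exp ((w.im : ℝ) * I) := by
    intro w
    rw [ofReal_exp, ← exp_add, re_add_im]
  have hH : DifferentiableOn ℂ (fun w => exp w • F (exp w))
      (uIcc (Real.log r) (Real.log R) ×ℂ uIcc (-δ) δ) := by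
    refine differentiable_exp.differentiableOn.smul
      (hF.comp differentiable_exp.differentiableOn fun w hw => ?_)
    rw [uIcc_of_le hlog, uIcc_of_le (by linarith)] at hw
    rw [hexp]
    exact mem_hankelRegion hr hδ ((Real.log_le_iff_le_exp hr).1 hw.1.1) (abs_le.2 hw.2)
  have hrect := integral_boundary_rect_eq_zero_of_differentiableOn
    (fun w => exp w • F (exp w)) (⟨Real.log r, -δ⟩ : ℂ) ⟨Real.log R, δ⟩ hH
  simp only at hrect
  have harc : ∀ s : ℝ, 0 < s →
      I • ∫ y in (-δ)..δ, exp ((Real.log s : ℝ) + y * I) • F (exp ((Real.log s : ℝ) + y * I))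
      = ∫ φ in (-δ)..δ, (I * ((s : ℂ) * exp (φ * I))) • F ((s : ℂ) * exp (φ * I)) := by
    intro s hs
    rw [← intervalIntegral.integral_smul]
    refine intervalIntegral.integral_congr fun y _ => ?_
    simp only [exp_add, ← ofReal_exp, Real.exp_log hs, smul_smul]
  rw [integral_exp_smul_ray hr hrR (hray (-δ) (by rw [abs_neg, abs_of_pos hδ0])),
    integral_exp_smul_ray hr hrR (hray δ (abs_of_pos hδ0).le), harc R hR, harc r hr] at hrect
  have h1' : IntegrableOn (fun ρ : ℝ => exp (δ * I) • F ((ρ : ℂ) * exp (δ * I))) (Ioi r) :=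
    Integrable.smul _ h1
  have h2' : IntegrableOn
      (fun ρ : ℝ => exp ((-δ : ℝ) * I) • F ((ρ : ℂ) * exp ((-δ : ℝ) * I))) (Ioi r) :=
    Integrable.smul _ h2
  have e1 := intervalIntegral.integral_interval_add_Ioi h1' (h1'.mono_set (Ioi_subset_Ioi hrR))
  have e2 := intervalIntegral.integral_interval_add_Ioi h2' (h2'.mono_set (Ioi_subset_Ioi hrR))
  unfold hankelIntegral
  simp only [← neg_mul, ← ofReal_neg]
  rw [← e1, ← e2, ← sub_eq_zero]
  rw [← neg_eq_zero, ← hrect]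
  abel

theorem integrableOn_ray {E : Type*} [NormedAddCommGroup E] (hr : 0 < r)
    (hδ : δ < Real.pi) {F : ℂ → E}
    (hF : ContinuousOn F (hankelRegion r δ)) {φ : ℝ} (hφ : |φ| ≤ δ) {B : ℝ → ℝ}
    (hB : IntegrableOn B (Ioi r)) (h : ∀ ρ : ℝ, r < ρ → ‖F ((ρ : ℂ) * exp (φ * I))‖ ≤ B ρ) :
    IntegrableOn (fun ρ : ℝ => F ((ρ : ℂ) * exp (φ * I))) (Ioi r) := by
  refine Integrable.mono' hB ?_ ?_
  · refine ContinuousOn.aestronglyMeasurable ?_ measurableSet_Ioi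
    exact hF.comp (by fun_prop) fun ρ hρ => mem_hankelRegion hr hδ (le_of_lt hρ) hφ
  · exact (ae_restrict_iff' measurableSet_Ioi).2 (Filter.Eventually.of_forall h)

/-- Closing a Hankel path to the right: the integral of a holomorphic function that decays faster
than `1 / |λ|` vanishes. -/
theorem hankelIntegral_eq_zero (hr : 0 < r) (hδ0 : 0 < δ) (hδ : δ < Real.pi) {F : ℂ → E}
    (hF : DifferentiableOn ℂ F (hankelRegion r δ)) {C q : ℝ} (hq : 1 < q)
    (hC : ∀ l ∈ hankelRegion r δ, ‖F l‖ ≤ C * ‖l‖ ^ (-q)) : hankelIntegral r δ F = 0 := by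
  have hbd : ∀ ρ φ : ℝ, r ≤ ρ → |φ| ≤ δ → ‖F ((ρ : ℂ) * exp (φ * I))‖ ≤ C * ρ ^ (-q) := by
    intro ρ φ hρ hφ
    have := hC _ (mem_hankelRegion hr hδ hρ hφ)
    rwa [norm_ofReal_mul_exp (hr.le.trans hρ)] at this
  have hδδ : |δ| ≤ δ := (abs_of_pos hδ0).le
  have hδδ' : |-δ| ≤ δ := by rw [abs_neg]; exact hδδ
  have hint : ∀ R, 0 < R → IntegrableOn (fun ρ : ℝ => C * ρ ^ (-q)) (Ioi R) := fun R hR =>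
    (integrableOn_Ioi_rpow_of_lt (by linarith) hR).const_mul C
  have hle : ∀ R, r ≤ R →
      ‖hankelIntegral r δ F‖ ≤ (2 * δ * C + 2 * C / (q - 1)) * R ^ (-(q - 1)) := by
    intro R hR
    have hR0 : 0 < R := hr.trans_le hR
    rw [hankelIntegral_eq_of_le hr hδ0 hδ hR hF
      (integrableOn_ray hr hδ hF.continuousOn hδδ (hint r hr) fun ρ hρ => hbd ρ _ hρ.le hδδ)
      (integrableOn_ray hr hδ hF.continuousOn hδδ' (hint r hr) fun ρ hρ => hbd ρ _ hρ.le hδδ')]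
    refine (norm_hankelIntegral_le hR0 hδ0 (fun φ hφ => hbd R φ hR hφ)
      (fun ρ hρ => hbd ρ _ (hR.trans hρ.le) hδδ) (fun ρ hρ => hbd ρ _ (hR.trans hρ.le) hδδ')
      (hint R hR0)).trans (le_of_eq ?_)
    rw [integral_const_mul, integral_Ioi_rpow_of_lt (by linarith) hR0]
    have e : R ^ (-(q - 1)) = R * R ^ (-q) := by
      rw [show -(q - 1) = 1 + -q by ring, Real.rpow_add hR0, Real.rpow_one]
    have e' : -q + 1 = -(q - 1) := by ring
    have hq' : q - 1 ≠ 0 := by linarith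
    rw [e', neg_div_neg_eq, e]
    field_simp
  have hlim : Filter.Tendsto (fun R : ℝ => (2 * δ * C + 2 * C / (q - 1)) * R ^ (-(q - 1)))
      Filter.atTop (𝓝 0) := by
    have := (tendsto_rpow_neg_atTop (y := q - 1) (by linarith)).const_mul
      (2 * δ * C + 2 * C / (q - 1))
    rwa [mul_zero] at this
  have : ‖hankelIntegral r δ F‖ ≤ 0 := by
    refine ge_of_tendsto hlim ?_
    filter_upwards [Filter.eventually_ge_atTop r] with R hR using hle R hR
  exact norm_le_zero_iff.1 this

theorem norm_exp_ofReal_mul_exp_mul (ρ φ t : ℝ) :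
    ‖exp ((ρ : ℂ) * exp (φ * I) * t)‖ = Real.exp (ρ * Real.cos φ * t) := by
  rw [norm_exp, re_mul_ofReal, re_ofReal_mul_exp]

/-- A holomorphic `F = O(|λ| ^ (-β))`, `β ≥ 0`, has a Hankel integral
`∫ e^{λ t} F(λ) dλ = O(t ^ (β - 1))` on bounded time intervals. To see this, integrate over the
Hankel path of radius `max r (1 / t)`. The constant is proportional to that of `F`. -/
theorem exists_norm_hankelIntegral_exp_le (hr : 0 < r) (hδ0 : Real.pi / 2 < δ) (hδ : δ < Real.pi)
    {β : ℝ} (hβ : 0 ≤ β) (T : ℝ) : ∃ K : ℝ, 0 ≤ K ∧ ∀ (F : ℂ → E) (C : ℝ),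
      DifferentiableOn ℂ F (hankelRegion r δ) →
      (∀ l ∈ hankelRegion r δ, ‖F l‖ ≤ C * ‖l‖ ^ (-β)) → ∀ t : ℝ, 0 < t → t ≤ T →
      ‖hankelIntegral r δ (fun l => exp (l * t) • F l)‖ ≤ K * C * t ^ (β - 1) := by
  have hpi := Real.pi_pos
  have hδp : 0 < δ := by linarith
  set c : ℝ := -Real.cos δ with hc_def
  have hc : 0 < c := by
    have := Real.cos_neg_of_pi_div_two_lt_of_lt hδ0 (by linarith)
    linarith
  refine ⟨2 * δ * ((|r * T| + 1) * Real.exp (|r * T| + 1)) + 2 / c, by positivity, ?_⟩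
  intro F C hF hC t ht htT
  have hC0 : 0 ≤ C := by
    have h := (norm_nonneg _).trans
      (hC _ (mem_hankelRegion hr hδ (φ := 0) le_rfl (by simp; linarith)))
    rw [norm_ofReal_mul_exp hr.le] at h
    exact nonneg_of_mul_nonneg_left h (Real.rpow_pos_of_pos hr _)
  set R : ℝ := max r (1 / t) with hR_def
  have hrR : r ≤ R := le_max_left _ _
  have htR : 1 / t ≤ R := le_max_right _ _
  have hR0 : 0 < R := hr.trans_le hrR
  have hRt : R * t ≤ |r * T| + 1 := by
    rw [hR_def, max_mul_of_nonneg _ _ ht.le]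
    refine max_le ?_ ?_
    · have := le_abs_self (r * T)
      nlinarith
    · rw [one_div_mul_cancel ht.ne']
      linarith [abs_nonneg (r * T)]
  have hRβ : R ^ (-β) ≤ t ^ β := by
    have h := Real.rpow_le_rpow_of_nonpos (by positivity) htR (neg_nonpos.2 hβ)
    rwa [one_div, Real.inv_rpow ht.le, Real.rpow_neg ht.le, inv_inv] at h
  have hδδ : |δ| ≤ δ := (abs_of_pos hδp).le
  have hδδ' : |-δ| ≤ δ := by rw [abs_neg]; exact hδδ
  have hcos : ∀ φ : ℝ, φ = δ ∨ φ = -δ → Real.cos φ = -c := by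
    rintro φ (rfl | rfl) <;> simp [hc_def]
  have hray : ∀ s φ : ℝ, 0 < s → r ≤ s → (φ = δ ∨ φ = -δ) → ∀ ρ : ℝ, s < ρ →
      ‖exp ((ρ : ℂ) * exp (φ * I) * t) • F ((ρ : ℂ) * exp (φ * I))‖
        ≤ C * s ^ (-β) * Real.exp (-(c * t) * ρ) := by
    intro s φ hs hrs hφ ρ hρ
    have hρ0 : 0 < ρ := hs.trans hρ
    have hφ' : |φ| ≤ δ := by rcases hφ with rfl | rfl <;> assumption
    have h1 := hC _ (mem_hankelRegion hr hδ (hrs.trans hρ.le) hφ')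
    rw [norm_ofReal_mul_exp hρ0.le] at h1
    rw [norm_smul, norm_exp_ofReal_mul_exp_mul, hcos φ hφ, mul_comm]
    have h2 : ρ ^ (-β) ≤ s ^ (-β) := Real.rpow_le_rpow_of_nonpos hs hρ.le (neg_nonpos.2 hβ)
    have h3 : ρ * -c * t = -(c * t) * ρ := by ring
    rw [h3]
    gcongr
    exact h1.trans (by gcongr)
  have hct : -(c * t) < 0 := by
    have := mul_pos hc ht
    linarith
  have hint : ∀ s : ℝ, IntegrableOn (fun ρ : ℝ => C * s ^ (-β) * Real.exp (-(c * t) * ρ)) (Ioi s) :=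
    fun s => (integrableOn_exp_mul_Ioi hct s).const_mul _
  have hG : DifferentiableOn ℂ (fun l => exp (l * t) • F l) (hankelRegion r δ) :=
    DifferentiableOn.smul (by fun_prop) hF
  rw [hankelIntegral_eq_of_le hr hδp hδ hrR hG
    (integrableOn_ray hr hδ hG.continuousOn hδδ (hint r) (hray r δ hr le_rfl (Or.inl rfl)))
    (integrableOn_ray hr hδ hG.continuousOn hδδ' (hint r) (hray r (-δ) hr le_rfl (Or.inr rfl)))]
  refine (norm_hankelIntegral_le (m := Real.exp (|r * T| + 1) * (C * R ^ (-β))) hR0 hδp ?_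
    (hray R δ hR0 hrR (Or.inl rfl)) (hray R (-δ) hR0 hrR (Or.inr rfl)) (hint R)).trans ?_
  · intro φ hφ
    have h1 := hC _ (mem_hankelRegion hr hδ hrR hφ)
    rw [norm_ofReal_mul_exp hR0.le] at h1
    rw [norm_smul, norm_exp_ofReal_mul_exp_mul]
    gcongr
    have := Real.cos_le_one φ
    nlinarith [mul_pos hR0 ht]
  · rw [integral_const_mul, integral_exp_mul_Ioi hct]
    have e1 : t ^ (β - 1) = t ^ β / t := by rw [Real.rpow_sub_one ht.ne']
    have e2 : Real.exp (-(c * t) * R) ≤ 1 := Real.exp_le_one_iff.2 (by nlinarith)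
    have e3 : -Real.exp (-(c * t) * R) / -(c * t) ≤ 1 / c * (1 / t) := by
      rw [neg_div_neg_eq, one_div_mul_one_div]
      gcongr
    have e4 : R ≤ (|r * T| + 1) * (1 / t) := by
      rw [mul_one_div, le_div_iff₀ ht]
      exact hRt
    have hRβ0 : 0 ≤ R ^ (-β) := by positivity
    calc 2 * δ * (R * (Real.exp (|r * T| + 1) * (C * R ^ (-β))))
          + 2 * (C * R ^ (-β) * (-Real.exp (-(c * t) * R) / -(c * t)))
        ≤ 2 * δ * (((|r * T| + 1) * (1 / t)) * (Real.exp (|r * T| + 1) * (C * t ^ β)))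
          + 2 * (C * t ^ β * (1 / c * (1 / t))) := by
          have e5 : 0 ≤ -Real.exp (-(c * t) * R) / -(c * t) := by
            rw [neg_div_neg_eq]; positivity
          gcongr
      _ = _ := by
          rw [e1]
          field_simp

end Contour

/-! ### Hankel integrals as integrals over the real line -/

section Curve
open Complex MeasureTheory Set
variable {E : Type*} [NormedAddCommGroup E] [NormedSpace ℂ E] {r δ : ℝ}

/-- A parametrization of the Hankel path by the whole real line: the rays are `|x| ≥ r`, with
`|λ| = |x|`, and the arc is `|x| ≤ r`, with `arg λ = δ x / r`. -/
noncomputable def hankelCurve (r δ x : ℝ) : ℂ :=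
  ((max |x| r : ℝ) : ℂ) * exp ((δ * max (-1) (min (x / r) 1) : ℝ) * I)

/-- The velocity of `hankelCurve`, away from the corners `x = ± r`. -/
noncomputable def hankelVel (r δ x : ℝ) : ℂ :=
  if x ≤ -r then -exp ((-δ : ℝ) * I)
  else if x ≤ r then δ * (I * exp ((δ * (x / r) : ℝ) * I)) else exp ((δ : ℝ) * I)

/-- Absolute convergence of an integral along the Hankel path. -/
def HankelIntegrable (r δ : ℝ) (F : ℂ → E) : Prop :=
  Integrable (fun x => hankelVel r δ x • F (hankelCurve r δ x))

theorem continuous_hankelCurve : Continuous (hankelCurve r δ) := by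
  unfold hankelCurve
  fun_prop

theorem measurable_hankelVel : Measurable (hankelVel r δ) := by
  unfold hankelVel
  refine Measurable.ite measurableSet_Iic measurable_const
    (Measurable.ite measurableSet_Iic ?_ measurable_const)
  fun_prop

theorem norm_hankelVel_le (hδ : 0 < δ) (x : ℝ) : ‖hankelVel r δ x‖ ≤ max 1 δ := by
  unfold hankelVel
  split_ifs
  · rw [norm_neg, norm_exp_ofReal_mul_I]; exact le_max_left _ _
  · rw [norm_mul, norm_mul, norm_exp_ofReal_mul_I, norm_I, norm_real, Real.norm_of_nonneg hδ.le]
    simp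
  · rw [norm_exp_ofReal_mul_I]; exact le_max_left _ _

theorem norm_hankelCurve (hr : 0 < r) (x : ℝ) : ‖hankelCurve r δ x‖ = max |x| r :=
  norm_ofReal_mul_exp (hr.le.trans (le_max_right _ _)) _

theorem hankelCurve_mem (hr : 0 < r) (hδ0 : 0 < δ) (hδ : δ < Real.pi) (x : ℝ) :
    hankelCurve r δ x ∈ hankelRegion r δ := by
  refine mem_hankelRegion hr hδ (le_max_right _ _) ?_
  rw [abs_mul, abs_of_pos hδ0]
  refine mul_le_of_le_one_right hδ0.le (abs_le.2 ⟨le_max_left _ _, max_le (by norm_num) ?_⟩)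
  exact min_le_right _ _

theorem hankelCurve_of_le_neg (hr : 0 < r) {x : ℝ} (hx : x ≤ -r) :
    hankelCurve r δ x = ((-x : ℝ) : ℂ) * exp ((-δ : ℝ) * I) := by
  have h1 : x / r ≤ -1 := by rw [div_le_iff₀ hr]; linarith
  rw [hankelCurve, abs_of_neg (by linarith), max_eq_left (by linarith),
    min_eq_left (by linarith), max_eq_left h1, mul_neg_one]

theorem hankelCurve_of_mem (hr : 0 < r) {x : ℝ} (hx : x ∈ Icc (-r) r) :
    hankelCurve r δ x = (r : ℂ) * exp ((δ * (x / r) : ℝ) * I) := by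
  have h1 : -1 ≤ x / r := by rw [le_div_iff₀ hr]; linarith [hx.1]
  have h2 : x / r ≤ 1 := by rw [div_le_iff₀ hr]; linarith [hx.2]
  rw [hankelCurve, max_eq_right (abs_le.2 hx), min_eq_left h2, max_eq_right h1]

theorem hankelCurve_of_le (hr : 0 < r) {x : ℝ} (hx : r ≤ x) :
    hankelCurve r δ x = (x : ℂ) * exp ((δ : ℝ) * I) := by
  have h1 : 1 ≤ x / r := by rw [le_div_iff₀ hr]; linarith
  rw [hankelCurve, abs_of_pos (by linarith), max_eq_left hx, min_eq_right h1,
    max_eq_right (by norm_num), mul_one]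

theorem hankelIntegral_eq_integral (hr : 0 < r) {F : ℂ → E}
    (hF : HankelIntegrable r δ F) :
    hankelIntegral r δ F = ∫ x, hankelVel r δ x • F (hankelCurve r δ x) := by
  rw [HankelIntegrable] at hF
  rw [← intervalIntegral.integral_Iic_add_Ioi (b := -r) hF.integrableOn hF.integrableOn,
    ← intervalIntegral.integral_interval_add_Ioi (b := r) hF.integrableOn hF.integrableOn]
  have h1 : ∫ x in Iic (-r), hankelVel r δ x • F (hankelCurve r δ x)
      = -∫ ρ in Ioi r, exp (-(δ * I)) • F ((ρ : ℂ) * exp (-(δ * I))) := by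
    have h := integral_comp_neg_Iic (-r)
      (fun ρ : ℝ => exp (-(δ * I)) • F ((ρ : ℂ) * exp (-(δ * I))))
    rw [neg_neg] at h
    rw [← h, ← integral_neg]
    refine setIntegral_congr_fun measurableSet_Iic fun x hx => ?_
    simp only [hankelVel, if_pos (mem_Iic.1 hx), hankelCurve_of_le_neg hr (mem_Iic.1 hx),
      ofReal_neg, neg_mul, neg_smul]
  have h2 : ∫ x in (-r)..r, hankelVel r δ x • F (hankelCurve r δ x)
      = ∫ φ in (-δ)..δ, (I * ((r : ℂ) * exp (φ * I))) • F ((r : ℂ) * exp (φ * I)) := by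
    have h := intervalIntegral.smul_integral_comp_mul_left (a := -r) (b := r)
      (fun φ : ℝ => (I * ((r : ℂ) * exp (φ * I))) • F ((r : ℂ) * exp (φ * I))) (δ / r)
    rw [mul_neg, div_mul_cancel₀ _ hr.ne'] at h
    rw [← h, ← intervalIntegral.integral_smul]
    refine intervalIntegral.integral_congr_ae ?_
    have hne : ∀ᵐ x : ℝ, x ≠ -r := by simp [ae_iff]
    filter_upwards [hne] with x hx hmem
    rw [uIoc_of_le (by linarith)] at hmem
    have hx1 : ¬ x ≤ -r := not_le.2 hmem.1
    rw [hankelVel, if_neg hx1, if_pos hmem.2, hankelCurve_of_mem hr ⟨hmem.1.le, hmem.2⟩,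
      ← coe_smul, smul_smul]
    have e : δ * (x / r) = δ / r * x := by ring
    have hr' : (r : ℂ) ≠ 0 := ofReal_ne_zero.2 hr.ne'
    rw [e]
    congr 1
    push_cast
    field_simp
  have h3 : ∫ x in Ioi r, hankelVel r δ x • F (hankelCurve r δ x)
      = ∫ ρ in Ioi r, exp (δ * I) • F ((ρ : ℂ) * exp (δ * I)) := by
    refine setIntegral_congr_fun measurableSet_Ioi fun x hx => ?_
    have hx' : r < x := hx
    have hx1 : ¬ x ≤ -r := by linarith
    simp only [hankelVel, if_neg hx1, if_neg (not_le.2 hx'), hankelCurve_of_le hr hx'.le]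
  rw [h1, h2, h3]
  unfold hankelIntegral
  abel

theorem HankelIntegrable.clm_apply {E' : Type*} [NormedAddCommGroup E'] [NormedSpace ℂ E']
    {F : ℂ → E} (hF : HankelIntegrable r δ F) (L : E →L[ℂ] E') :
    HankelIntegrable r δ (fun l => L (F l)) := by
  have := L.integrable_comp hF
  simpa only [HankelIntegrable, map_smul] using this

theorem HankelIntegrable.hankelIntegral_clm_apply {E' : Type*} [NormedAddCommGroup E']
    [NormedSpace ℂ E'] [CompleteSpace E] [CompleteSpace E'] (hr : 0 < r)
    {F : ℂ → E} (hF : HankelIntegrable r δ F) (L : E →L[ℂ] E') :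
    hankelIntegral r δ (fun l => L (F l)) = L (hankelIntegral r δ F) := by
  rw [hankelIntegral_eq_integral hr hF, hankelIntegral_eq_integral hr (hF.clm_apply L),
    ← L.integral_comp_comm hF]
  simp only [map_smul]

theorem HankelIntegrable.sub {F G : ℂ → E} (hF : HankelIntegrable r δ F)
    (hG : HankelIntegrable r δ G) : HankelIntegrable r δ (fun l => F l - G l) := by
  have h : Integrable (fun x => hankelVel r δ x • F (hankelCurve r δ x)
      - hankelVel r δ x • G (hankelCurve r δ x)) := Integrable.sub hF hG
  simpa only [HankelIntegrable, smul_sub] using h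

theorem HankelIntegrable.hankelIntegral_sub (hr : 0 < r) {F G : ℂ → E}
    (hF : HankelIntegrable r δ F) (hG : HankelIntegrable r δ G) :
    hankelIntegral r δ (fun l => F l - G l) = hankelIntegral r δ F - hankelIntegral r δ G := by
  rw [hankelIntegral_eq_integral hr hF, hankelIntegral_eq_integral hr hG,
    hankelIntegral_eq_integral hr (hF.sub hG), ← integral_sub hF hG]
  simp only [smul_sub]

theorem aestronglyMeasurable_hankelCurve (hr : 0 < r) (hδ0 : 0 < δ) (hδ : δ < Real.pi)
    {F : ℂ → E} (hF : ContinuousOn F (hankelRegion r δ)) :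
    AEStronglyMeasurable (fun x => hankelVel r δ x • F (hankelCurve r δ x)) := by
  have h : Continuous fun x => F (hankelCurve r δ x) :=
    hF.comp_continuous continuous_hankelCurve (hankelCurve_mem hr hδ0 hδ)
  exact measurable_hankelVel.aestronglyMeasurable.smul h.aestronglyMeasurable

theorem integrable_max_rpow (hr : 0 < r) {q : ℝ} (hq : 1 < q) :
    Integrable (fun x : ℝ => (max |x| r) ^ (-q)) := by
  have h1 : Integrable (fun x : ℝ => (1 + ‖x‖) ^ (-q)) :=
    integrable_one_add_norm (by simpa using hq)
  refine (h1.const_mul ((r / (1 + r)) ^ (-q))).mono' ?_ ?_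
  · refine Continuous.aestronglyMeasurable ?_
    refine Continuous.rpow_const (by fun_prop) fun x => Or.inl ?_
    exact (hr.trans_le (le_max_right _ _)).ne'
  · refine Filter.Eventually.of_forall fun x => ?_
    have hm : 0 < max |x| r := hr.trans_le (le_max_right _ _)
    rw [Real.norm_of_nonneg (by positivity), ← Real.mul_rpow (by positivity) (by positivity)]
    refine Real.rpow_le_rpow_of_nonpos (by positivity) ?_ (by linarith)
    rw [div_mul_eq_mul_div, div_le_iff₀ (by positivity), Real.norm_eq_abs]
    have h1 := le_max_left |x| r
    have h2 := le_max_right |x| r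
    nlinarith

theorem hankelIntegrable_of_norm_le (hr : 0 < r) (hδ0 : 0 < δ) (hδ : δ < Real.pi) {F : ℂ → E}
    (hF : ContinuousOn F (hankelRegion r δ)) {C q : ℝ} (hq : 1 < q)
    (hC : ∀ x, ‖F (hankelCurve r δ x)‖ ≤ C * ‖hankelCurve r δ x‖ ^ (-q)) :
    HankelIntegrable r δ F := by
  refine ((integrable_max_rpow hr hq).const_mul (max 1 δ * C)).mono'
    (aestronglyMeasurable_hankelCurve hr hδ0 hδ hF) (Filter.Eventually.of_forall fun x => ?_)
  have h := hC x
  rw [norm_hankelCurve hr] at h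
  rw [norm_smul, mul_assoc]
  exact mul_le_mul (norm_hankelVel_le hδ0 x) h (norm_nonneg _) (by positivity)

theorem norm_exp_hankelCurve_le (hr : 0 < r) {t : ℝ} (ht : 0 ≤ t) (x : ℝ) :
    ‖exp (hankelCurve r δ x * t)‖ ≤
      Real.exp (2 * r * t) * Real.exp (Real.cos δ * t * ‖hankelCurve r δ x‖) := by
  rw [norm_hankelCurve hr, ← Real.exp_add]
  rcases le_or_gt |x| r with h | h
  · rw [hankelCurve_of_mem hr (abs_le.1 h), norm_exp_ofReal_mul_exp_mul, max_eq_right h]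
    refine Real.exp_le_exp.2 ?_
    have h1 := Real.cos_le_one (δ * (x / r))
    have h2 := Real.neg_one_le_cos δ
    have h3 : 0 ≤ r * t := by positivity
    nlinarith
  · rw [max_eq_left h.le]
    have h0 : 0 ≤ 2 * r * t := by positivity
    rcases lt_abs.1 h with h' | h'
    · rw [hankelCurve_of_le hr h'.le, norm_exp_ofReal_mul_exp_mul, abs_of_pos (hr.trans h')]
      refine Real.exp_le_exp.2 ?_
      linarith
    · rw [hankelCurve_of_le_neg hr (by linarith), norm_exp_ofReal_mul_exp_mul,
        abs_of_neg (by linarith), Real.cos_neg]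
      refine Real.exp_le_exp.2 ?_
      linarith

theorem exists_exp_neg_mul_le_rpow (hr : 0 < r) {a : ℝ} (ha : 0 < a) (p : ℝ) :
    ∃ K : ℝ, 0 ≤ K ∧ ∀ ρ, r ≤ ρ → Real.exp (-a * ρ) ≤ K * ρ ^ p := by
  have h := tendsto_rpow_mul_exp_neg_mul_atTop_nhds_zero (-p) a ha
  obtain ⟨N, hN⟩ := Filter.eventually_atTop.1 (h.eventually (gt_mem_nhds zero_lt_one))
  have hcont : ContinuousOn (fun ρ : ℝ => ρ ^ (-p) * Real.exp (-a * ρ)) (Icc r N) := by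
    refine ContinuousOn.mul ?_ (by fun_prop)
    exact continuousOn_id.rpow_const fun x hx => Or.inl (hr.trans_le hx.1).ne'
  obtain ⟨K, hK⟩ := isCompact_Icc.exists_bound_of_continuousOn hcont
  refine ⟨max K 1, by positivity, fun ρ hρ => ?_⟩
  have hρ0 : 0 < ρ := hr.trans_le hρ
  have hle : ρ ^ (-p) * Real.exp (-a * ρ) ≤ max K 1 := by
    rcases le_total ρ N with h' | h'
    · exact ((le_abs_self _).trans (hK ρ ⟨hρ, h'⟩)).trans (le_max_left _ _)
    · exact (hN ρ h').le.trans (le_max_right _ _)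
  have e : Real.exp (-a * ρ) = (ρ ^ (-p) * Real.exp (-a * ρ)) * ρ ^ p := by
    rw [mul_right_comm, ← Real.rpow_add hρ0, neg_add_cancel, Real.rpow_zero, one_mul]
  rw [e]
  gcongr

/-- On the Hankel path, `e^{λ t}` beats every power of `|λ|`, locally uniformly in `t > 0`. -/
theorem exists_norm_exp_hankelCurve_le (hr : 0 < r) (hδ0 : Real.pi / 2 < δ) (hδ : δ < Real.pi)
    {t : ℝ} (ht : 0 < t) (p : ℝ) : ∃ K : ℝ, 0 ≤ K ∧ ∀ s ∈ Icc (t / 2) (2 * t), ∀ x,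
      ‖exp (hankelCurve r δ x * s)‖ ≤ K * ‖hankelCurve r δ x‖ ^ p := by
  have hcos := Real.cos_neg_of_pi_div_two_lt_of_lt hδ0 (by linarith)
  obtain ⟨K, hK0, hK⟩ := exists_exp_neg_mul_le_rpow (p := p) hr
    (a := -Real.cos δ * (t / 2)) (by have := neg_pos.2 hcos; positivity)
  refine ⟨Real.exp (2 * r * (2 * t)) * K, by positivity, fun s hs x => ?_⟩
  have hs0 : 0 ≤ s := by linarith [hs.1]
  refine (norm_exp_hankelCurve_le hr hs0 x).trans ?_
  have hx : r ≤ ‖hankelCurve r δ x‖ := by rw [norm_hankelCurve hr]; exact le_max_right _ _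
  rw [mul_assoc _ K]
  have h2 : Real.exp (2 * r * s) ≤ Real.exp (2 * r * (2 * t)) := by
    have := hs.2
    gcongr
  refine mul_le_mul h2 (le_trans (Real.exp_le_exp.2 ?_) (hK _ hx)) (Real.exp_pos _).le
    (Real.exp_pos _).le
  have h3 : 0 < ‖hankelCurve r δ x‖ := hr.trans_le hx
  have h4 : Real.cos δ * s ≤ Real.cos δ * (t / 2) := by nlinarith [hs.1]
  nlinarith

theorem norm_exp_smul_hankelCurve_le (hr : 0 < r) (hδ0 : Real.pi / 2 < δ) (hδ : δ < Real.pi)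
    {F : ℂ → E} {C β : ℝ} (hC : ∀ l ∈ hankelRegion r δ, ‖F l‖ ≤ C * ‖l‖ ^ (-β))
    {t : ℝ} (ht : 0 < t) : ∃ K : ℝ, ∀ s ∈ Icc (t / 2) (2 * t), ∀ x,
      ‖exp (hankelCurve r δ x * s) • F (hankelCurve r δ x)‖
        ≤ K * ‖hankelCurve r δ x‖ ^ (-2 : ℝ) := by
  have hpi := Real.pi_pos
  obtain ⟨K, hK0, hK⟩ := exists_norm_exp_hankelCurve_le hr hδ0 hδ ht (β - 2)
  refine ⟨K * C, fun s hs x => ?_⟩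
  have hmem := hankelCurve_mem hr (by linarith) hδ x
  have hpos : 0 < ‖hankelCurve r δ x‖ := hr.trans_le hmem.1
  have e : ‖hankelCurve r δ x‖ ^ (-2 : ℝ)
      = ‖hankelCurve r δ x‖ ^ (β - 2) * ‖hankelCurve r δ x‖ ^ (-β) := by
    rw [← Real.rpow_add hpos]
    congr 1
    ring
  rw [norm_smul, e, mul_mul_mul_comm]
  exact mul_le_mul (hK s hs x) (hC _ hmem) (norm_nonneg _) (by positivity)

theorem hankelIntegrable_exp_smul (hr : 0 < r) (hδ0 : Real.pi / 2 < δ) (hδ : δ < Real.pi)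
    {F : ℂ → E} (hF : ContinuousOn F (hankelRegion r δ)) {C β : ℝ}
    (hC : ∀ l ∈ hankelRegion r δ, ‖F l‖ ≤ C * ‖l‖ ^ (-β)) {t : ℝ} (ht : 0 < t) :
    HankelIntegrable r δ (fun l => exp (l * t) • F l) := by
  have hpi := Real.pi_pos
  obtain ⟨K, hK⟩ := norm_exp_smul_hankelCurve_le hr hδ0 hδ hC ht
  exact hankelIntegrable_of_norm_le hr (by linarith) hδ (ContinuousOn.smul (by fun_prop) hF)
    one_lt_two (hK t ⟨by linarith, by linarith⟩)

theorem norm_smul_le_rpow (hr : 0 < r) {F : ℂ → E} {C β : ℝ}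
    (hC : ∀ l ∈ hankelRegion r δ, ‖F l‖ ≤ C * ‖l‖ ^ (-β)) :
    ∀ l ∈ hankelRegion r δ, ‖l • F l‖ ≤ C * ‖l‖ ^ (-(β - 1)) := by
  intro l hl
  have hpos : 0 < ‖l‖ := hr.trans_le hl.1
  rw [norm_smul, show -(β - 1) = 1 + -β by ring, Real.rpow_add hpos, Real.rpow_one, mul_left_comm]
  gcongr
  exact hC l hl

/-- Differentiation of `∫ e^{λ t} F(λ) dλ` under the integral sign. -/
theorem hasDerivAt_hankelIntegral_exp_smul (hr : 0 < r) (hδ0 : Real.pi / 2 < δ)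
    (hδ : δ < Real.pi) {F : ℂ → E} (hF : ContinuousOn F (hankelRegion r δ)) {C β : ℝ}
    (hC : ∀ l ∈ hankelRegion r δ, ‖F l‖ ≤ C * ‖l‖ ^ (-β)) {t : ℝ} (ht : 0 < t) :
    HasDerivAt (fun s : ℝ => hankelIntegral r δ (fun l => exp (l * s) • F l))
      (hankelIntegral r δ (fun l => exp (l * t) • l • F l)) t := by
  have hpi := Real.pi_pos
  have hδp : 0 < δ := by linarith
  have hF' : ContinuousOn (fun l => l • F l) (hankelRegion r δ) := continuousOn_id.smul hF
  have hC' := norm_smul_le_rpow hr hC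
  obtain ⟨K, hK⟩ := norm_exp_smul_hankelCurve_le hr hδ0 hδ hC' ht
  have hnhds : Ioo (t / 2) (2 * t) ∈ 𝓝 t := Ioo_mem_nhds (by linarith) (by linarith)
  have hint : ∀ s : ℝ, 0 < s → HankelIntegrable r δ (fun l => exp (l * s) • F l) :=
    fun s hs => hankelIntegrable_exp_smul hr hδ0 hδ hF hC hs
  have hint' := hankelIntegrable_exp_smul hr hδ0 hδ hF' hC' ht
  have key := (hasDerivAt_integral_of_dominated_loc_of_deriv_le (𝕜 := ℝ) (x₀ := t)
    (F := fun (s : ℝ) x => hankelVel r δ x • exp (hankelCurve r δ x * s) • F (hankelCurve r δ x))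
    (F' := fun (s : ℝ) x => hankelVel r δ x •
      exp (hankelCurve r δ x * s) • hankelCurve r δ x • F (hankelCurve r δ x))
    (bound := fun x => max 1 δ * K * (max |x| r) ^ (-2 : ℝ))
    hnhds ?_ (hint t ht) hint'.aestronglyMeasurable ?_
    ((integrable_max_rpow hr one_lt_two).const_mul _) ?_).2
  · rw [← hankelIntegral_eq_integral hr hint'] at key
    refine key.congr_of_eventuallyEq ?_
    filter_upwards [lt_mem_nhds ht] with s hs
    exact hankelIntegral_eq_integral hr (hint s hs)
  · filter_upwards [lt_mem_nhds ht] with s hs using (hint s hs).aestronglyMeasurable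
  · refine Filter.Eventually.of_forall fun x s hs => ?_
    have h := hK s ⟨hs.1.le, hs.2.le⟩ x
    rw [norm_hankelCurve hr] at h
    rw [norm_smul, mul_assoc]
    exact mul_le_mul (norm_hankelVel_le hδp x) h (norm_nonneg _) (by positivity)
  · refine Filter.Eventually.of_forall fun x s _ => ?_
    have h1 : HasDerivAt (fun s : ℝ => exp (hankelCurve r δ x * s))
        (exp (hankelCurve r δ x * s) * hankelCurve r δ x) s := by
      have h0 : HasDerivAt (fun s : ℝ => hankelCurve r δ x * (s : ℂ)) (hankelCurve r δ x) s := by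
        simpa using (ofRealCLM.hasDerivAt (x := s)).const_mul (hankelCurve r δ x)
      exact h0.cexp
    have h2 := (h1.smul_const (F (hankelCurve r δ x))).const_smul (hankelVel r δ x)
    rwa [mul_smul] at h2

/-- Fubini's theorem for the convolution of `∫ e^{λ s} F(λ) dλ` with an integrable kernel. -/
theorem intervalIntegral_smul_hankelIntegral [CompleteSpace E] (hr : 0 < r)
    (hδ0 : Real.pi / 2 < δ) (hδ : δ < Real.pi)
    {F : ℂ → E} (hF : ContinuousOn F (hankelRegion r δ)) {C q : ℝ} (hq : 1 < q)
    (hC : ∀ l ∈ hankelRegion r δ, ‖F l‖ ≤ C * ‖l‖ ^ (-q)) {τ : ℝ} (hτ : 0 < τ) {κ : ℝ → ℝ}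
    (hκ : IntervalIntegrable κ volume 0 τ) :
    HankelIntegrable r δ (fun l => (∫ s in (0 : ℝ)..τ, (κ s : ℂ) * exp (l * s)) • F l) ∧
    ∫ s in (0 : ℝ)..τ, κ s • hankelIntegral r δ (fun l => exp (l * s) • F l)
      = hankelIntegral r δ (fun l => (∫ s in (0 : ℝ)..τ, (κ s : ℂ) * exp (l * s)) • F l) := by
  have hpi := Real.pi_pos
  have hδp : 0 < δ := by linarith
  have hFi : HankelIntegrable r δ F := hankelIntegrable_of_norm_le hr hδp hδ hF hq
    fun x => hC _ (hankelCurve_mem hr hδp hδ x)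
  have hcos := Real.cos_neg_of_pi_div_two_lt_of_lt hδ0 (by linarith)
  have hexp : ∀ s ∈ Ioc 0 τ, ∀ x, ‖exp (hankelCurve r δ x * s)‖ ≤ Real.exp (2 * r * τ) := by
    intro s hs x
    refine (norm_exp_hankelCurve_le hr hs.1.le x).trans ?_
    have h1 : Real.exp (Real.cos δ * s * ‖hankelCurve r δ x‖) ≤ 1 := by
      refine Real.exp_le_one_iff.2 ?_
      have := mul_nonneg hs.1.le (norm_nonneg (hankelCurve r δ x))
      nlinarith
    have h2 : Real.exp (2 * r * s) ≤ Real.exp (2 * r * τ) := by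
      have := hs.2
      gcongr
    calc _ ≤ Real.exp (2 * r * s) * 1 := by gcongr
      _ ≤ _ := by rwa [mul_one]
  set ν := (volume : Measure ℝ).restrict (Ioc 0 τ) with hν
  have hκ' : Integrable κ ν := (intervalIntegrable_iff_integrableOn_Ioc_of_le hτ.le).1 hκ
  have hprod : Integrable (fun z : ℝ × ℝ => exp (hankelCurve r δ z.2 * z.1) •
      (κ z.1 • (hankelVel r δ z.2 • F (hankelCurve r δ z.2)))) (ν.prod volume) := by
    refine (Integrable.smul_prod hκ' hFi).bdd_smul (Real.exp (2 * r * τ)) ?_ ?_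
    · have := continuous_hankelCurve (r := r) (δ := δ)
      refine Continuous.aestronglyMeasurable ?_
      fun_prop
    · have h : ∀ᵐ z ∂(ν.prod (volume : Measure ℝ)), z.1 ∈ Ioc 0 τ :=
        Measure.quasiMeasurePreserving_fst.ae (ae_restrict_mem measurableSet_Ioc)
      filter_upwards [h] with z hz using hexp z.1 hz z.2
  have hswap := integral_integral_swap (μ := ν) (ν := volume)
    (f := fun s x => exp (hankelCurve r δ x * s) •
      (κ s • (hankelVel r δ x • F (hankelCurve r δ x)))) hprod
  have e1 : ∀ x, ∫ s, exp (hankelCurve r δ x * s) •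
      (κ s • (hankelVel r δ x • F (hankelCurve r δ x))) ∂ν
      = hankelVel r δ x • (∫ s in (0 : ℝ)..τ, (κ s : ℂ) * exp (hankelCurve r δ x * s)) •
        F (hankelCurve r δ x) := by
    intro x
    rw [intervalIntegral.integral_of_le hτ.le, smul_smul, mul_comm, ← smul_smul,
      ← integral_smul_const]
    refine integral_congr_ae (Filter.Eventually.of_forall fun s => ?_)
    simp only [← coe_smul, smul_smul]
    congr 1
    ring
  have hint : HankelIntegrable r δ
      (fun l => (∫ s in (0 : ℝ)..τ, (κ s : ℂ) * exp (l * s)) • F l) := by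
    have := hprod.integral_prod_right
    simp only [e1] at this
    exact this
  refine ⟨hint, ?_⟩
  rw [hankelIntegral_eq_integral hr hint, intervalIntegral.integral_of_le hτ.le]
  simp only [e1] at hswap
  rw [← hswap]
  refine setIntegral_congr_fun measurableSet_Ioc fun s hs => ?_
  rw [hankelIntegral_eq_integral hr (hankelIntegrable_exp_smul hr hδ0 hδ hF hC hs.1),
    ← integral_smul]
  refine integral_congr_ae (Filter.Eventually.of_forall fun x => ?_)
  simp only [← coe_smul, smul_smul]
  congr 1
  ring

/-- Hankel's integral for `1 / Γ(1)`. In the variable `w = log λ` the integrand is the entire,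
`2πi`-periodic function `exp (t e^w)`, which is small in the strip `δ ≤ Im w ≤ 2π - δ` as
`Re w → ∞`; so the Hankel path can be replaced by the circle `|λ| = r`. -/
theorem hankelIntegral_exp_smul_inv (hr : 0 < r) (hδ0 : Real.pi / 2 < δ) (hδ : δ < Real.pi)
    {t : ℝ} (ht : 0 < t) :
    hankelIntegral r δ (fun l => exp (l * t) • l⁻¹) = 2 * (Real.pi : ℂ) * I := by
  have hpi := Real.pi_pos
  have hδp : 0 < δ := by linarith
  set F : ℂ → ℂ := fun l => exp (l * t) • l⁻¹ with hF_def
  set ζ : ℝ := 2 * Real.pi - δ with hζ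
  have hδζ : δ ≤ ζ := by linarith
  have hexpζ : exp ((ζ : ℝ) * I) = exp (-(δ * I)) := by
    rw [hζ, show ((2 * Real.pi - δ : ℝ) : ℂ) * I = -(δ * I) + 2 * Real.pi * I by push_cast; ring,
      exp_periodic]
  have hcos := Real.cos_neg_of_pi_div_two_lt_of_lt hδ0 (by linarith)
  have hcosζ : Real.cos ζ = Real.cos δ := Real.cos_two_pi_sub δ
  have hFcont : ContinuousOn F {0}ᶜ := by
    refine ContinuousOn.smul (f := fun l : ℂ => exp (l * t)) (by fun_prop) continuousOn_inv₀
  have hne : ∀ s φ : ℝ, 0 < s → (s : ℂ) * exp (φ * I) ≠ 0 := fun s φ hs =>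
    mul_ne_zero (ofReal_ne_zero.2 hs.ne') (exp_ne_zero _)
  have hraycont : ∀ φ R : ℝ, ContinuousOn (fun ρ : ℝ => F ((ρ : ℂ) * exp (φ * I))) (Icc r R) :=
    fun φ R => hFcont.comp (f := fun ρ : ℝ => (ρ : ℂ) * exp (φ * I)) (by fun_prop)
      fun ρ hρ => hne ρ φ (hr.trans_le hρ.1)
  -- the part of the circle of radius `s` which the Hankel path leaves out
  set arc : ℝ → ℂ := fun s =>
    ∫ φ in δ..ζ, (I * ((s : ℂ) * exp (φ * I))) • F ((s : ℂ) * exp (φ * I)) with harc_def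
  have harcF : ∀ s φ : ℝ, 0 < s → (I * ((s : ℂ) * exp (φ * I))) • F ((s : ℂ) * exp (φ * I))
      = I * exp ((s : ℂ) * exp (φ * I) * t) := by
    intro s φ hs
    have := hne s φ hs
    simp only [hF_def, smul_eq_mul]
    rw [mul_comm (exp _), ← mul_assoc, mul_assoc I, mul_inv_cancel₀ this, mul_one]
  have hrect : ∀ R, r ≤ R → (∫ ρ in r..R, exp (δ * I) • F ((ρ : ℂ) * exp (δ * I)))
      - (∫ ρ in r..R, exp (-(δ * I)) • F ((ρ : ℂ) * exp (-(δ * I)))) = arc r - arc R := by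
    intro R hrR
    have hR : 0 < R := hr.trans_le hrR
    have hH : DifferentiableOn ℂ (fun w => exp w • F (exp w))
        (uIcc (Real.log r) (Real.log R) ×ℂ uIcc δ ζ) := by
      have : (fun w => exp w • F (exp w)) = fun w => exp (exp w * t) := by
        funext w
        have := exp_ne_zero w
        simp only [hF_def, smul_eq_mul]
        field_simp
      rw [this]
      fun_prop
    have h := integral_boundary_rect_eq_zero_of_differentiableOn
      (fun w => exp w • F (exp w)) (⟨Real.log r, δ⟩ : ℂ) ⟨Real.log R, ζ⟩ hH
    simp only at h
    have harc : ∀ s : ℝ, 0 < s →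
        I • ∫ y in δ..ζ, exp ((Real.log s : ℝ) + y * I) • F (exp ((Real.log s : ℝ) + y * I))
        = arc s := by
      intro s hs
      rw [← intervalIntegral.integral_smul]
      refine intervalIntegral.integral_congr fun y _ => ?_
      simp only [exp_add, ← ofReal_exp, Real.exp_log hs, smul_smul]
    rw [integral_exp_smul_ray hr hrR (hraycont δ R), integral_exp_smul_ray hr hrR (hraycont ζ R),
      harc R hR, harc r hr, hexpζ] at h
    rw [← sub_eq_zero, ← h]
    ring
  have hbd : ∀ s φ : ℝ, 0 < s → φ ∈ Icc δ ζ →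
      ‖exp ((s : ℂ) * exp (φ * I) * t)‖ ≤ Real.exp (-(-Real.cos δ * t) * s) := by
    intro s φ hs hφ
    rw [norm_exp_ofReal_mul_exp_mul]
    refine Real.exp_le_exp.2 ?_
    have h : Real.cos φ ≤ Real.cos δ := by
      rcases le_total φ Real.pi with h' | h'
      · exact Real.cos_le_cos_of_nonneg_of_le_pi hδp.le h' hφ.1
      · rw [← Real.cos_two_pi_sub φ]
        exact Real.cos_le_cos_of_nonneg_of_le_pi hδp.le (by linarith) (by linarith [hφ.2])
    have hst : 0 < s * t := by positivity
    nlinarith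
  have ha : 0 < -Real.cos δ * t := by have := neg_pos.2 hcos; positivity
  have harc0 : Filter.Tendsto arc Filter.atTop (𝓝 0) := by
    have h := (tendsto_rpow_mul_exp_neg_mul_atTop_nhds_zero 0 _ ha).mul_const (|ζ - δ|)
    rw [zero_mul] at h
    refine squeeze_zero_norm' ?_ h
    filter_upwards [Filter.eventually_gt_atTop 0] with s hs
    rw [Real.rpow_zero, one_mul]
    refine intervalIntegral.norm_integral_le_of_norm_le_const fun φ hφ => ?_
    rw [uIoc_of_le hδζ] at hφ
    rw [harcF s φ hs, norm_mul, norm_I, one_mul]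
    exact hbd s φ hs ⟨hφ.1.le, hφ.2⟩
  have hray : ∀ φ : ℝ, φ = δ ∨ φ = ζ →
      IntegrableOn (fun ρ : ℝ => exp (φ * I) • F ((ρ : ℂ) * exp (φ * I))) (Ioi r) := by
    intro φ hφ
    refine Integrable.mono'
      ((integrableOn_exp_mul_Ioi (a := -(-Real.cos δ * t)) (by linarith) r).const_mul r⁻¹) ?_ ?_
    · refine ContinuousOn.aestronglyMeasurable ?_ measurableSet_Ioi
      have h : ContinuousOn (fun ρ : ℝ => F ((ρ : ℂ) * exp (φ * I))) (Ioi r) :=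
        hFcont.comp (by fun_prop) fun ρ hρ => hne ρ φ (hr.trans hρ)
      exact ContinuousOn.smul (f := fun _ : ℝ => exp (φ * I)) continuousOn_const h
    · refine (ae_restrict_iff' measurableSet_Ioi).2 (Filter.Eventually.of_forall fun ρ hρ => ?_)
      have hρ' : r < ρ := hρ
      have hρ0 : 0 < ρ := hr.trans hρ
      simp only [hF_def]
      rw [norm_smul, norm_smul, norm_exp_ofReal_mul_I, one_mul, mul_comm, norm_inv,
        norm_ofReal_mul_exp hρ0.le]
      have h1 := hbd ρ φ hρ0 (by rcases hφ with rfl | rfl <;> simp [hδζ])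
      gcongr
  have hδint := hray δ (Or.inl rfl)
  have hζint := hray ζ (Or.inr rfl)
  rw [hexpζ] at hζint
  have hlim : (∫ ρ in Ioi r, exp (δ * I) • F ((ρ : ℂ) * exp (δ * I)))
      - (∫ ρ in Ioi r, exp (-(δ * I)) • F ((ρ : ℂ) * exp (-(δ * I)))) = arc r := by
    have h1 := (intervalIntegral_tendsto_integral_Ioi r hδint Filter.tendsto_id).sub
      (intervalIntegral_tendsto_integral_Ioi r hζint Filter.tendsto_id)
    have h2 := harc0.const_sub (arc r)
    rw [sub_zero] at h2
    refine tendsto_nhds_unique h1 (h2.congr' ?_)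
    filter_upwards [Filter.eventually_ge_atTop r] with R hR using (hrect R hR).symm
  set g : ℝ → ℂ := fun φ => (I * ((r : ℂ) * exp (φ * I))) • F ((r : ℂ) * exp (φ * I)) with hg
  have hgcont : Continuous g := by
    have h : Continuous fun φ : ℝ => F ((r : ℂ) * exp (φ * I)) :=
      hFcont.comp_continuous (by fun_prop) fun φ => hne r φ hr
    exact Continuous.smul (f := fun φ : ℝ => I * ((r : ℂ) * exp (φ * I))) (by fun_prop) h
  have hper : Function.Periodic g (2 * Real.pi) := by
    intro φ
    have : exp (((φ + 2 * Real.pi : ℝ) : ℂ) * I) = exp (φ * I) := by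
      rw [show ((φ + 2 * Real.pi : ℝ) : ℂ) * I = φ * I + 2 * Real.pi * I by push_cast; ring,
        exp_periodic]
    simp only [hg, this]
  have htotal : hankelIntegral r δ F = ∫ φ in (0 : ℝ)..2 * Real.pi, g φ := by
    have h1 : hankelIntegral r δ F = (∫ φ in (-δ)..δ, g φ) + arc r := by
      rw [← hlim, hankelIntegral, add_sub_assoc]
    rw [h1, intervalIntegral.integral_add_adjacent_intervals (hgcont.intervalIntegrable _ _)
      (hgcont.intervalIntegrable _ _)]
    have h2 := hper.intervalIntegral_add_eq (-δ) 0
    rwa [zero_add, show -δ + 2 * Real.pi = ζ by rw [hζ]; ring] at h2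
  have hcirc := DifferentiableOn.circleIntegral_sub_inv_smul (c := 0) (w := 0) (R := r)
    (f := fun z : ℂ => exp (z * t)) (by fun_prop) (Metric.mem_ball_self hr)
  rw [htotal]
  rw [zero_mul, exp_zero, smul_eq_mul, mul_one] at hcirc
  rw [← hcirc, circleIntegral]
  refine intervalIntegral.integral_congr fun φ _ => ?_
  simp only [hg, hF_def, deriv_circleMap, circleMap_zero, sub_zero, smul_eq_mul]
  ring

end Curve

/-! ### Convolution with a power of the variable -/

section Kernel
open Complex MeasureTheory Set
variable {E : Type*} [NormedAddCommGroup E] [NormedSpace ℂ E] {r δ α : ℝ}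

theorem differentiableAt_integral_mul_exp {ν : Measure ℝ} {κ : ℝ → ℝ} {l : ℂ} {U : Set ℂ}
    {bound : ℝ → ℝ} (hU : U ∈ 𝓝 l) (hκ : AEStronglyMeasurable κ ν)
    (hint : Integrable (fun s => (κ s : ℂ) * exp (l * s)) ν)
    (hb : ∀ᵐ s ∂ν, ∀ z ∈ U, ‖(κ s : ℂ) * (exp (z * s) * s)‖ ≤ bound s)
    (hbound : Integrable bound ν) :
    DifferentiableAt ℂ (fun z => ∫ s, (κ s : ℂ) * exp (z * s) ∂ν) l := by
  have hκ' : AEStronglyMeasurable (fun s => (κ s : ℂ)) ν :=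
    continuous_ofReal.comp_aestronglyMeasurable hκ
  refine (hasDerivAt_integral_of_dominated_loc_of_deriv_le hU ?_ hint
    (F' := fun z s => (κ s : ℂ) * (exp (z * s) * s)) ?_ hb hbound ?_).2.differentiableAt
  · refine Filter.Eventually.of_forall fun z => hκ'.mul ?_
    exact Continuous.aestronglyMeasurable (by fun_prop)
  · exact hκ'.mul (Continuous.aestronglyMeasurable (by fun_prop))
  · refine Filter.Eventually.of_forall fun s z _ => ?_
    have h : HasDerivAt (fun z : ℂ => z * (s : ℂ)) s z := by
      simpa using (hasDerivAt_id z).mul_const (s : ℂ)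
    exact h.cexp.const_mul _

theorem differentiable_intervalIntegral_mul_exp {τ : ℝ} (hτ : 0 ≤ τ) {κ : ℝ → ℝ}
    (hκ : IntervalIntegrable κ volume 0 τ) :
    Differentiable ℂ (fun z => ∫ s in (0 : ℝ)..τ, (κ s : ℂ) * exp (z * s)) := by
  intro l
  simp only [intervalIntegral.integral_of_le hτ]
  have hκ' := (intervalIntegrable_iff_integrableOn_Ioc_of_le hτ).1 hκ
  have hexp : ∀ z ∈ Metric.ball l 1, ∀ s ∈ Ioc 0 τ, ‖exp (z * s)‖ ≤ Real.exp ((‖l‖ + 1) * τ) := by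
    intro z hz s hs
    rw [norm_exp, re_mul_ofReal]
    refine Real.exp_le_exp.2 ?_
    have h1 : z.re ≤ ‖l‖ + 1 := by
      have h2 := (le_abs_self _).trans (abs_re_le_norm z)
      have h3 := norm_sub_norm_le z l
      rw [mem_ball_iff_norm] at hz
      linarith
    have := norm_nonneg l
    exact mul_le_mul h1 hs.2 hs.1.le (by positivity)
  refine differentiableAt_integral_mul_exp
    (bound := fun s => |κ s| * (Real.exp ((‖l‖ + 1) * τ) * τ))
    (Metric.ball_mem_nhds l one_pos) hκ'.aestronglyMeasurable ?_ ?_ (hκ'.abs.mul_const _)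
  · refine Integrable.mono' (hκ'.abs.mul_const (Real.exp ((‖l‖ + 1) * τ))) ?_ ?_
    · exact (continuous_ofReal.comp_aestronglyMeasurable hκ'.aestronglyMeasurable).mul
        (Continuous.aestronglyMeasurable (by fun_prop))
    · refine (ae_restrict_iff' measurableSet_Ioc).2 (Filter.Eventually.of_forall fun s hs => ?_)
      rw [norm_mul, norm_real, Real.norm_eq_abs]
      gcongr
      exact hexp l (Metric.mem_ball_self one_pos) s hs
  · refine (ae_restrict_iff' measurableSet_Ioc).2 (Filter.Eventually.of_forall fun s hs z hz => ?_)
    rw [norm_mul, norm_mul, norm_real, norm_real, Real.norm_eq_abs, Real.norm_of_nonneg hs.1.le]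
    have := hexp z hz s hs
    have := hs.2
    have := hs.1
    gcongr

theorem intervalIntegrable_sub_rpow_neg (hα : α < 1) (a b c : ℝ) :
    IntervalIntegrable (fun s : ℝ => (c - s) ^ (-α)) volume a b := by
  have h := (intervalIntegral.intervalIntegrable_rpow' (a := c - a) (b := c - b) (r := -α)
    (by linarith)).comp_sub_left c
  rwa [sub_sub_cancel, sub_sub_cancel] at h

theorem integrable_rpow_neg_mul_exp_neg (hα : α < 1) {l : ℂ} (hl : 0 < l.re) :
    IntegrableOn (fun s : ℝ => ((s ^ (-α) : ℝ) : ℂ) * exp (-l * s)) (Ioi 0) := by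
  have h := integrableOn_rpow_mul_exp_neg_mul_rpow (s := -α) (p := 1) (b := l.re)
    (by linarith) one_pos hl
  refine h.mono' ?_ ?_
  · refine ContinuousOn.aestronglyMeasurable ?_ measurableSet_Ioi
    refine ContinuousOn.mul ?_ (by fun_prop)
    refine continuous_ofReal.comp_continuousOn ?_
    exact continuousOn_id.rpow_const fun s hs => Or.inl (ne_of_gt hs)
  · refine (ae_restrict_iff' measurableSet_Ioi).2 (Filter.Eventually.of_forall fun s hs => ?_)
    have hs' : 0 < s := hs
    rw [norm_mul, norm_real, Real.norm_of_nonneg (by positivity), norm_exp, re_mul_ofReal,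
      Real.rpow_one, neg_re]

/-- The Laplace transform of `s ^ (-α)` on the right half-plane. -/
theorem integral_rpow_neg_mul_exp_neg (hα : α < 1) {l : ℂ} (hl : 0 < l.re) :
    ∫ s in Ioi (0 : ℝ), ((s ^ (-α) : ℝ) : ℂ) * exp (-l * s)
      = Real.Gamma (1 - α) * l ^ ((α : ℂ) - 1) := by
  have hopen : IsOpen {z : ℂ | 0 < z.re} := isOpen_lt continuous_const continuous_re
  have hdiff : DifferentiableOn ℂ
      (fun z : ℂ => ∫ s in Ioi (0 : ℝ), ((s ^ (-α) : ℝ) : ℂ) * exp (-z * s))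
      {z : ℂ | 0 < z.re} := by
    intro z hz
    have hz' : 0 < z.re := hz
    refine DifferentiableAt.differentiableWithinAt ?_
    refine DifferentiableAt.comp z (g := fun w : ℂ => ∫ s in Ioi (0 : ℝ),
      ((s ^ (-α) : ℝ) : ℂ) * exp (w * s)) (f := fun z => -z) ?_ (by fun_prop)
    have hU : {w : ℂ | w.re < -(z.re / 2)} ∈ 𝓝 (-z) :=
      (isOpen_lt continuous_re continuous_const).mem_nhds (by
        change (-z).re < -(z.re / 2)
        rw [neg_re]
        linarith)
    have hb := integrableOn_rpow_mul_exp_neg_mul_rpow (s := 1 - α) (p := 1) (b := z.re / 2)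
      (by linarith) one_pos (by linarith)
    refine differentiableAt_integral_mul_exp hU ?_ (integrable_rpow_neg_mul_exp_neg hα hz) ?_ hb
    · refine ContinuousOn.aestronglyMeasurable ?_ measurableSet_Ioi
      exact continuousOn_id.rpow_const fun s hs => Or.inl (ne_of_gt hs)
    · refine (ae_restrict_iff' measurableSet_Ioi).2
        (Filter.Eventually.of_forall fun s hs w hw => ?_)
      have hs' : 0 < s := hs
      have hw' : w.re < -(z.re / 2) := hw
      rw [norm_mul, norm_mul, norm_real, norm_real, Real.norm_of_nonneg (by positivity),
        Real.norm_of_nonneg hs'.le, norm_exp, re_mul_ofReal, Real.rpow_one,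
        show 1 - α = -α + 1 by ring, Real.rpow_add hs', Real.rpow_one, mul_comm (Real.exp _),
        ← mul_assoc]
      gcongr
  have hdiff' : DifferentiableOn ℂ (fun z : ℂ => Real.Gamma (1 - α) * z ^ ((α : ℂ) - 1))
      {z : ℂ | 0 < z.re} := by
    refine DifferentiableOn.const_mul ?_ _
    refine differentiableOn_id.cpow_const fun z hz => Or.inl hz
  have hreal : ∀ x : ℝ, 0 < x → ∫ s in Ioi (0 : ℝ), ((s ^ (-α) : ℝ) : ℂ) * exp (-(x : ℂ) * s)
      = Real.Gamma (1 - α) * (x : ℂ) ^ ((α : ℂ) - 1) := by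
    intro x hx
    have h := Real.integral_rpow_mul_exp_neg_mul_Ioi (a := 1 - α) (by linarith) hx
    have e : (x : ℂ) ^ ((α : ℂ) - 1) = (((1 / x) ^ (1 - α) : ℝ) : ℂ) := by
      rw [one_div, Real.inv_rpow hx.le, ← Real.rpow_neg hx.le, neg_sub, ofReal_cpow hx.le]
      push_cast
      rfl
    rw [e, mul_comm, ← ofReal_mul, ← h, ← integral_complex_ofReal]
    refine setIntegral_congr_fun measurableSet_Ioi fun s _ => ?_
    rw [show 1 - α - 1 = -α by ring]
    push_cast
    rw [neg_mul]
  have hfreq : ∃ᶠ z in 𝓝[≠] (1 : ℂ), ∫ s in Ioi (0 : ℝ), ((s ^ (-α) : ℝ) : ℂ) * exp (-z * s)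
      = Real.Gamma (1 - α) * z ^ ((α : ℂ) - 1) := by
    have ht : Filter.Tendsto (fun x : ℝ => (x : ℂ)) (𝓝[≠] (1 : ℝ)) (𝓝[≠] (1 : ℂ)) := by
      refine tendsto_nhdsWithin_iff.2 ⟨?_, ?_⟩
      · exact (continuous_ofReal.tendsto' 1 1 ofReal_one).mono_left nhdsWithin_le_nhds
      · filter_upwards [self_mem_nhdsWithin] with x hx
        simpa using hx
    refine ht.frequently (Filter.Eventually.frequently ?_)
    exact (lt_mem_nhds one_pos).filter_mono nhdsWithin_le_nhds |>.mono hreal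
  exact (hdiff.analyticOnNhd hopen).eqOn_of_preconnected_of_frequently_eq
    (hdiff'.analyticOnNhd hopen) (convex_halfSpace_re_gt 0).isPreconnected
    (show (1 : ℂ) ∈ {z : ℂ | 0 < z.re} by simp) hfreq hl

/-- The convolution of `s ^ (-α)` with `e^{λ s}` on `[0, τ]`, minus
`Γ(1 - α) e^{λ τ} λ ^ (α - 1)`, which for `Re λ > 0` is the convolution on `(-∞, τ]`. -/
noncomputable def kernelDefect (α τ : ℝ) (l : ℂ) : ℂ :=
  (∫ s in (0 : ℝ)..τ, (((τ - s) ^ (-α) : ℝ) : ℂ) * exp (l * s))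
    - Real.Gamma (1 - α) * (exp (l * τ) * l ^ ((α : ℂ) - 1))

theorem differentiableOn_kernelDefect (hα : α < 1) {τ : ℝ} (hτ : 0 < τ) (hr : 0 < r)
    (hδ : δ < Real.pi) : DifferentiableOn ℂ (kernelDefect α τ) (hankelRegion r δ) := by
  unfold kernelDefect
  refine DifferentiableOn.sub ?_ (DifferentiableOn.const_mul (DifferentiableOn.mul ?_ ?_) _)
  · exact (differentiable_intervalIntegral_mul_exp hτ.le
      (intervalIntegrable_sub_rpow_neg hα 0 τ τ)).differentiableOn
  · fun_prop
  · exact differentiableOn_id.cpow_const fun z hz => mem_slitPlane_of_mem_hankelRegion hr hδ hz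

/-- For `Re λ > 0` the defect is the tail of a Laplace integral. -/
theorem kernelDefect_eq_integral_Ioi (hα : α < 1) {τ : ℝ} (hτ : 0 < τ) {l : ℂ} (hl : 0 < l.re) :
    kernelDefect α τ l
      = -(exp (l * τ) * ∫ s in Ioi τ, ((s ^ (-α) : ℝ) : ℂ) * exp (-l * s)) := by
  have hint := integrable_rpow_neg_mul_exp_neg hα hl
  have h1 : ∫ s in (0 : ℝ)..τ, (((τ - s) ^ (-α) : ℝ) : ℂ) * exp (l * s)
      = exp (l * τ) * ∫ s in (0 : ℝ)..τ, ((s ^ (-α) : ℝ) : ℂ) * exp (-l * s) := by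
    have h := intervalIntegral.integral_comp_sub_left (a := 0) (b := τ)
      (fun s : ℝ => ((s ^ (-α) : ℝ) : ℂ) * exp (l * (τ - s : ℝ))) τ
    rw [sub_self, sub_zero] at h
    simp only [sub_sub_cancel] at h
    rw [h, ← intervalIntegral.integral_const_mul]
    refine intervalIntegral.integral_congr fun s _ => ?_
    rw [mul_left_comm, ← exp_add]
    push_cast
    ring_nf
  have h2 := intervalIntegral.integral_interval_add_Ioi hint
    (hint.mono_set (Ioi_subset_Ioi hτ.le))
  have h3 := integral_rpow_neg_mul_exp_neg hα hl
  rw [kernelDefect, h1, mul_left_comm, ← h3, ← h2]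
  ring

/-- The defect is bounded on the whole region: for `Re λ ≤ 1` both of its terms are, and for
`Re λ > 1` it is the tail of a Laplace integral. -/
theorem exists_norm_kernelDefect_le (hα0 : 0 ≤ α) (hα : α < 1) {τ : ℝ} (hτ : 0 < τ) (hr : 0 < r) :
    ∃ K : ℝ, ∀ l ∈ hankelRegion r δ, ‖kernelDefect α τ l‖ ≤ K := by
  set J : ℝ := ∫ s in (0 : ℝ)..τ, (τ - s) ^ (-α) * Real.exp τ
  refine ⟨max (J + Real.Gamma (1 - α) * (Real.exp τ * r ^ (α - 1))) (τ ^ (-α)),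
    fun l hl => ?_⟩
  have hΓ : 0 < Real.Gamma (1 - α) := Real.Gamma_pos_of_pos (by linarith)
  rcases le_or_gt l.re 1 with h | h
  · refine le_max_of_le_left ((norm_sub_le _ _).trans (add_le_add ?_ ?_))
    · refine intervalIntegral.norm_integral_le_of_norm_le hτ.le
        (Filter.Eventually.of_forall fun s hs => ?_)
        ((intervalIntegrable_sub_rpow_neg hα 0 τ τ).mul_const _)
      have h0 : 0 ≤ τ - s := by linarith [hs.2]
      rw [norm_mul, norm_real, Real.norm_of_nonneg (by positivity), norm_exp, re_mul_ofReal]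
      gcongr
      nlinarith [hs.1, hs.2]
    · rw [norm_mul, norm_mul, norm_real, Real.norm_of_nonneg hΓ.le, norm_exp, re_mul_ofReal,
        show (α : ℂ) - 1 = ((α - 1 : ℝ) : ℂ) by push_cast; rfl, norm_cpow_real]
      have h1 : ‖l‖ ^ (α - 1) ≤ r ^ (α - 1) :=
        Real.rpow_le_rpow_of_nonpos hr hl.1 (by linarith)
      gcongr
      nlinarith
  · refine le_max_of_le_right ?_
    have hl0 : 0 < l.re := by linarith
    rw [kernelDefect_eq_integral_Ioi hα hτ hl0, norm_neg, norm_mul, norm_exp, re_mul_ofReal]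
    have h1 : ‖∫ s in Ioi τ, ((s ^ (-α) : ℝ) : ℂ) * exp (-l * s)‖
        ≤ ∫ s in Ioi τ, τ ^ (-α) * Real.exp (-l.re * s) := by
      refine norm_integral_le_of_norm_le ((integrableOn_exp_mul_Ioi (by linarith) τ).const_mul _) ?_
      refine (ae_restrict_iff' measurableSet_Ioi).2 (Filter.Eventually.of_forall fun s hs => ?_)
      have hs' : τ < s := hs
      have hs0 : 0 < s := hτ.trans hs'
      rw [norm_mul, norm_real, Real.norm_of_nonneg (by positivity), norm_exp, re_mul_ofReal,
        neg_re]
      have := Real.rpow_le_rpow_of_nonpos hτ hs'.le (neg_nonpos.2 hα0)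
      gcongr
    rw [integral_const_mul, integral_exp_mul_Ioi (by linarith)] at h1
    calc _ ≤ Real.exp (l.re * τ) * (τ ^ (-α) * (-Real.exp (-l.re * τ) / -l.re)) := by gcongr
      _ = τ ^ (-α) / l.re := by
        rw [neg_div_neg_eq, neg_mul, Real.exp_neg]
        field_simp
      _ ≤ τ ^ (-α) := div_le_self (by positivity) h.le

/-- Convolution with `s ^ (-α)` acts on `∫ e^{λ s} F(λ) dλ` as multiplication of `F(λ)` by
`Γ(1 - α) λ ^ (α - 1)`: the difference is the integral of a function that is holomorphic and
`O(|λ| ^ (-q))` to the right of the path. -/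
theorem integral_sub_rpow_smul_hankelIntegral [CompleteSpace E] (hα0 : 0 ≤ α) (hα : α < 1)
    (hr : 0 < r) (hδ0 : Real.pi / 2 < δ) (hδ : δ < Real.pi)
    {F : ℂ → E} (hF : DifferentiableOn ℂ F (hankelRegion r δ)) {C q : ℝ} (hq : 1 < q)
    (hC : ∀ l ∈ hankelRegion r δ, ‖F l‖ ≤ C * ‖l‖ ^ (-q)) {τ : ℝ} (hτ : 0 < τ) :
    ∫ s in (0 : ℝ)..τ, (τ - s) ^ (-α) • hankelIntegral r δ (fun l => exp (l * s) • F l)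
      = hankelIntegral r δ (fun l => (Real.Gamma (1 - α) : ℂ) •
          exp (l * τ) • l ^ ((α : ℂ) - 1) • F l) := by
  have hpi := Real.pi_pos
  have hδp : 0 < δ := by linarith
  obtain ⟨hint, heq⟩ := intervalIntegral_smul_hankelIntegral hr hδ0 hδ hF.continuousOn hq hC hτ
    (intervalIntegrable_sub_rpow_neg hα 0 τ τ)
  obtain ⟨K, hK⟩ := exists_norm_kernelDefect_le (δ := δ) hα0 hα hτ hr
  have hDF : DifferentiableOn ℂ (fun l => kernelDefect α τ l • F l) (hankelRegion r δ) :=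
    (differentiableOn_kernelDefect hα hτ hr hδ).smul hF
  have hDFC : ∀ l ∈ hankelRegion r δ, ‖kernelDefect α τ l • F l‖ ≤ K * C * ‖l‖ ^ (-q) := by
    intro l hl
    rw [norm_smul, mul_assoc]
    have := hK l hl
    exact mul_le_mul this (hC l hl) (norm_nonneg _) ((norm_nonneg _).trans this)
  have hD0 := hankelIntegral_eq_zero hr hδp hδ hDF hq hDFC
  have hDint : HankelIntegrable r δ (fun l => kernelDefect α τ l • F l) :=
    hankelIntegrable_of_norm_le hr hδp hδ hDF.continuousOn hq
      fun x => hDFC _ (hankelCurve_mem hr hδp hδ x)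
  rw [heq, ← sub_zero (hankelIntegral r δ _), ← hD0, ← hint.hankelIntegral_sub hr hDint]
  congr 1
  funext l
  rw [← sub_smul, kernelDefect, sub_sub_cancel, smul_smul, smul_smul, mul_assoc]

end Kernel

/-! ### The solution operators -/

section Solution
open Complex MeasureTheory Set
variable {X : Type*} [NormedAddCommGroup X] [NormedSpace ℂ X]
  {A : X →ₗ.[ℂ] X} {M θ α μ r δ : ℝ}

theorem IsHankelPath.delta_pos (hP : IsHankelPath θ α μ r δ) : 0 < δ := by
  have := hP.lt_delta
  have := Real.pi_pos
  linarith

theorem IsHankelPath.cpow_mem_resolventSet (hA : IsSectorial A M θ α μ)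
    (hP : IsHankelPath θ α μ r δ) {l : ℂ} (hl : l ∈ hankelRegion r δ) :
    l ^ (α : ℂ) ∈ resolventSet A :=
  hA.mem_resolventSet l (hP.avoids l hl.1 hl.2)

/-- Far from the origin `|λ ^ α - μ|` is comparable to `|λ| ^ α`; on the remaining compact part of
the region it does not vanish, because the vertex `μ` belongs to `μ + S_θ`. -/
theorem exists_norm_resolventOp_le (hA : IsSectorial A M θ α μ) (hP : IsHankelPath θ α μ r δ)
    (hα0 : 0 < α) : ∃ C : ℝ, 0 ≤ C ∧ ∀ l ∈ hankelRegion r δ,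
      ‖resolventOp A (l ^ (α : ℂ))‖ ≤ C * ‖l‖ ^ (-α) := by
  have hr := hP.r_pos
  have hδ := hP.delta_lt
  have hne : ∀ l ∈ hankelRegion r δ, 0 < ‖l ^ (α : ℂ) - (μ : ℂ)‖ := by
    intro l hl
    refine norm_pos_iff.2 fun h => hP.avoids l hl.1 hl.2 ?_
    rw [h]
    simpa [sector] using hA.theta_pos
  set R : ℝ := (2 * |μ|) ^ (α⁻¹) with hR
  set f : ℂ → ℝ := fun l => ‖l‖ ^ α / ‖l ^ (α : ℂ) - (μ : ℂ)‖ with hf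
  have hf_cont : ContinuousOn (fun z : ℝ × ℝ => f ((z.1 : ℂ) * exp (z.2 * I)))
      (Icc r R ×ˢ Icc (-δ) δ) := by
    have hc : ContinuousOn f (hankelRegion r δ) := by
      refine ContinuousOn.div ?_ ?_ fun l hl => (hne l hl).ne'
      · exact continuous_norm.continuousOn.rpow_const fun l _ => Or.inr hα0.le
      · refine ContinuousOn.norm (ContinuousOn.sub ?_ continuousOn_const)
        exact continuousOn_id.cpow_const
          fun l hl => mem_slitPlane_of_mem_hankelRegion hr hδ hl
    exact hc.comp (f := fun z : ℝ × ℝ => (z.1 : ℂ) * exp (z.2 * I)) (by fun_prop)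
      fun z hz => mem_hankelRegion hr hδ hz.1.1 (abs_le.2 hz.2)
  obtain ⟨B, hB⟩ := (isCompact_Icc.prod isCompact_Icc).exists_bound_of_continuousOn hf_cont
  have hfB : ∀ l ∈ hankelRegion r δ, f l ≤ max B 2 := by
    intro l hl
    rcases le_total ‖l‖ R with h | h
    · have h1 := (le_abs_self _).trans (hB (‖l‖, arg l) ⟨⟨hl.1, h⟩, abs_le.1 hl.2⟩)
      simp only [norm_mul_exp_arg_mul_I] at h1
      exact h1.trans (le_max_left _ _)
    · refine le_trans ?_ (le_max_right _ _)
      rw [hf, div_le_iff₀ (hne l hl)]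
      have h1 : 2 * |μ| ≤ ‖l‖ ^ α := by
        have h2 := Real.rpow_le_rpow (by positivity) h hα0.le
        rwa [hR, Real.rpow_inv_rpow (by positivity) hα0.ne'] at h2
      have h3 := norm_sub_norm_le (l ^ (α : ℂ)) (μ : ℂ)
      rw [norm_cpow_real, norm_real, Real.norm_eq_abs] at h3
      linarith
  refine ⟨M * max B 2, mul_nonneg hA.M_pos.le (by positivity), fun l hl => ?_⟩
  refine (hA.norm_resolventOp_le l (hP.avoids l hl.1 hl.2)).trans ?_
  have hl0 : 0 < ‖l‖ := hr.trans_le hl.1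
  have h := hfB l hl
  have e : M / ‖l ^ (α : ℂ) - (μ : ℂ)‖ = M * f l * ‖l‖ ^ (-α) := by
    rw [hf, Real.rpow_neg hl0.le]
    have := (Real.rpow_pos_of_pos hl0 α).ne'
    field_simp
  rw [e]
  have := hA.M_pos
  gcongr

/-- The operator `A R(λ ^ α, A) = λ ^ α R(λ ^ α, A) - I`. -/
noncomputable def aResolvent (A : X →ₗ.[ℂ] X) (α : ℝ) (l : ℂ) : X →L[ℂ] X :=
  l ^ (α : ℂ) • resolventOp A (l ^ (α : ℂ)) - 1

theorem aResolvent_apply (l : ℂ) (y : X) :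
    aResolvent A α l y = l ^ (α : ℂ) • resolventOp A (l ^ (α : ℂ)) y - y := by
  simp [aResolvent]

theorem differentiableOn_cpow (hP : IsHankelPath θ α μ r δ) (c : ℂ) :
    DifferentiableOn ℂ (fun l : ℂ => l ^ c) (hankelRegion r δ) :=
  differentiableOn_id.cpow_const
    fun _ hl => mem_slitPlane_of_mem_hankelRegion hP.r_pos hP.delta_lt hl

theorem differentiableOn_resolventOp (hA : IsSectorial A M θ α μ) (hP : IsHankelPath θ α μ r δ)
    (hα0 : 0 < α) :
    DifferentiableOn ℂ (fun l : ℂ => resolventOp A (l ^ (α : ℂ))) (hankelRegion r δ) := by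
  obtain ⟨C, hC0, hC⟩ := exists_norm_resolventOp_le hA hP hα0
  refine differentiableOn_of_resolvent_identity (C := C * r ^ (-α)) (differentiableOn_cpow hP _)
    (fun l hl => (hC l hl).trans ?_) fun l hl w hw =>
      resolventOp_sub (hP.cpow_mem_resolventSet hA hl) (hP.cpow_mem_resolventSet hA hw)
  have := Real.rpow_le_rpow_of_nonpos hP.r_pos hl.1 (neg_nonpos.2 hα0.le)
  gcongr

theorem differentiableOn_aResolvent (hA : IsSectorial A M θ α μ) (hP : IsHankelPath θ α μ r δ)
    (hα0 : 0 < α) : DifferentiableOn ℂ (aResolvent A α) (hankelRegion r δ) :=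
  ((differentiableOn_cpow hP _).smul (differentiableOn_resolventOp hA hP hα0)).sub_const _

theorem differentiableOn_aResolvent_apply (hA : IsSectorial A M θ α μ)
    (hP : IsHankelPath θ α μ r δ) (hα0 : 0 < α) (y : X) :
    DifferentiableOn ℂ (fun l => aResolvent A α l y) (hankelRegion r δ) :=
  (differentiableOn_aResolvent hA hP hα0).clm_apply (differentiableOn_const y)

theorem exists_norm_aResolvent_le (hA : IsSectorial A M θ α μ) (hP : IsHankelPath θ α μ r δ)
    (hα0 : 0 < α) : ∃ C : ℝ, 0 ≤ C ∧ ∀ l ∈ hankelRegion r δ, ∀ y,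
      ‖aResolvent A α l y‖ ≤ C * ‖y‖ := by
  obtain ⟨C, hC0, hC⟩ := exists_norm_resolventOp_le hA hP hα0
  refine ⟨C + 1, by positivity, fun l hl y => ?_⟩
  have hl0 : 0 < ‖l‖ := hP.r_pos.trans_le hl.1
  rw [aResolvent_apply, add_mul, one_mul]
  refine (norm_sub_le _ _).trans (add_le_add ?_ le_rfl)
  rw [norm_smul, norm_cpow_real]
  have h1 := (resolventOp A (l ^ (α : ℂ))).le_of_opNorm_le (hC l hl) y
  calc _ ≤ ‖l‖ ^ α * (C * ‖l‖ ^ (-α) * ‖y‖) := by gcongr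
    _ = C * ‖y‖ := by
      rw [Real.rpow_neg hl0.le]
      have := (Real.rpow_pos_of_pos hl0 α).ne'
      field_simp

/-- On the domain of `A` one has `A R(λ ^ α, A) y = R(λ ^ α, A) A y`, which decays. -/
theorem exists_norm_aResolvent_le_of_mem (hA : IsSectorial A M θ α μ) (hP : IsHankelPath θ α μ r δ)
    (hα0 : 0 < α) {y : X} (hy : y ∈ A.domain) :
    ∃ C : ℝ, 0 ≤ C ∧ ∀ l ∈ hankelRegion r δ, ‖aResolvent A α l y‖ ≤ C * ‖l‖ ^ (-α) := by
  obtain ⟨C, hC0, hC⟩ := exists_norm_resolventOp_le hA hP hα0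
  refine ⟨C * ‖A ⟨y, hy⟩‖, by positivity, fun l hl => ?_⟩
  have h := smul_resolventOp_sub (hP.cpow_mem_resolventSet hA hl) ⟨y, hy⟩
  simp only at h
  rw [aResolvent_apply, h, mul_right_comm]
  exact (resolventOp A (l ^ (α : ℂ))).le_of_opNorm_le (hC l hl) _

/-- `(2πi)⁻¹ ∫ e^{λ t} m(λ) A R(λ ^ α, A) y dλ` along the Hankel path, for a scalar symbol `m`. -/
noncomputable def symbolOp (A : X →ₗ.[ℂ] X) (α r δ : ℝ) (m : ℂ → ℂ) (y : X) (t : ℝ) : X :=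
  (2 * (Real.pi : ℂ) * I)⁻¹ • hankelIntegral r δ (fun l => exp (l * t) • m l • aResolvent A α l y)

theorem norm_smul_aResolvent_le {m : ℂ → ℂ} {B β : ℝ} (hr : 0 < r)
    (hm : ∀ l ∈ hankelRegion r δ, ‖m l‖ ≤ ‖l‖ ^ (-β)) {y : X} {γ : ℝ}
    (hB : ∀ l ∈ hankelRegion r δ, ‖aResolvent A α l y‖ ≤ B * ‖l‖ ^ (-γ)) :
    ∀ l ∈ hankelRegion r δ, ‖m l • aResolvent A α l y‖ ≤ B * ‖l‖ ^ (-(β + γ)) := by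
  intro l hl
  have hl0 : 0 < ‖l‖ := hr.trans_le hl.1
  rw [norm_smul, neg_add, Real.rpow_add hl0, mul_left_comm]
  exact mul_le_mul (hm l hl) (hB l hl) (norm_nonneg _) (by positivity)

theorem norm_cpow_sub_one_le (α : ℝ) (l : ℂ) :
    ‖l ^ ((α : ℂ) - 1)‖ ≤ ‖l‖ ^ (-(1 - α)) := by
  rw [show (α : ℂ) - 1 = ((α - 1 : ℝ) : ℂ) by push_cast; rfl, norm_cpow_real, neg_sub]

theorem norm_inv_le_rpow (l : ℂ) : ‖l⁻¹‖ ≤ ‖l‖ ^ (-1 : ℝ) := by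
  rw [norm_inv, Real.rpow_neg_one]

theorem hankelIntegrable_symbol (hA : IsSectorial A M θ α μ)
    (hP : IsHankelPath θ α μ r δ) (hα0 : 0 < α) {m : ℂ → ℂ} {β : ℝ}
    (hm : ContinuousOn m (hankelRegion r δ)) (hmβ : ∀ l ∈ hankelRegion r δ, ‖m l‖ ≤ ‖l‖ ^ (-β))
    (y : X) {t : ℝ} (ht : 0 < t) :
    HankelIntegrable r δ (fun l => exp (l * t) • m l • aResolvent A α l y) := by
  obtain ⟨C, hC0, hC⟩ := exists_norm_aResolvent_le hA hP hα0
  refine hankelIntegrable_exp_smul hP.r_pos hP.lt_delta hP.delta_lt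
    (hm.smul (differentiableOn_aResolvent_apply hA hP hα0 y).continuousOn)
    (norm_smul_aResolvent_le (B := C * ‖y‖) (γ := 0) hP.r_pos hmβ fun l hl => ?_) ht
  rw [neg_zero, Real.rpow_zero, mul_one]
  exact hC l hl y

theorem hasDerivAt_symbolOp (hA : IsSectorial A M θ α μ)
    (hP : IsHankelPath θ α μ r δ) (hα0 : 0 < α) {m : ℂ → ℂ} {β : ℝ}
    (hm : ContinuousOn m (hankelRegion r δ)) (hmβ : ∀ l ∈ hankelRegion r δ, ‖m l‖ ≤ ‖l‖ ^ (-β))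
    (y : X) {t : ℝ} (ht : 0 < t) :
    HasDerivAt (symbolOp A α r δ m y) (symbolOp A α r δ (fun l => l * m l) y t) t := by
  obtain ⟨C, hC0, hC⟩ := exists_norm_aResolvent_le hA hP hα0
  have h := hasDerivAt_hankelIntegral_exp_smul hP.r_pos hP.lt_delta hP.delta_lt
    (hm.smul (differentiableOn_aResolvent_apply hA hP hα0 y).continuousOn)
    (norm_smul_aResolvent_le (B := C * ‖y‖) (γ := 0) hP.r_pos hmβ fun l hl => by
      rw [neg_zero, Real.rpow_zero, mul_one]
      exact hC l hl y) ht
  have h' := h.const_smul ((2 * (Real.pi : ℂ) * I)⁻¹)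
  simp only [symbolOp, mul_smul]
  exact h'

theorem resolventOp_aResolvent (hA : IsSectorial A M θ α μ) (hP : IsHankelPath θ α μ r δ) {z l : ℂ}
    (hz : z ∈ resolventSet A) (hl : l ∈ hankelRegion r δ) (y : X) :
    resolventOp A z (aResolvent A α l y) = aResolvent A α l (resolventOp A z y) := by
  have h := DFunLike.congr_fun (resolventOp_mul_comm hz (hP.cpow_mem_resolventSet hA hl)) y
  simp only [mul_apply_eq_comp] at h
  simp only [aResolvent_apply, map_sub, map_smul, h]

theorem resolventOp_symbolOp [CompleteSpace X] (hA : IsSectorial A M θ α μ)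
    (hP : IsHankelPath θ α μ r δ)
    (hα0 : 0 < α) {m : ℂ → ℂ} {β : ℝ} (hm : ContinuousOn m (hankelRegion r δ))
    (hmβ : ∀ l ∈ hankelRegion r δ, ‖m l‖ ≤ ‖l‖ ^ (-β)) {z : ℂ} (hz : z ∈ resolventSet A)
    (y : X) {t : ℝ} (ht : 0 < t) :
    resolventOp A z (symbolOp A α r δ m y t) = symbolOp A α r δ m (resolventOp A z y) t := by
  have h := (hankelIntegrable_symbol hA hP hα0 hm hmβ y ht).hankelIntegral_clm_apply hP.r_pos
    (resolventOp A z)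
  rw [symbolOp, map_smul, ← h, symbolOp]
  congr 1
  refine hankelIntegral_congr hP.r_pos hP.delta_pos hP.delta_lt fun l hl => ?_
  rw [map_smul, map_smul, resolventOp_aResolvent hA hP hz hl]

theorem hankelIntegrable_exp_cpow_smul_resolventOp (hA : IsSectorial A M θ α μ)
    (hP : IsHankelPath θ α μ r δ) (hα0 : 0 < α) {t : ℝ} (ht : 0 < t) :
    HankelIntegrable r δ
      (fun l => (exp (l * t) * l ^ ((α : ℂ) - 1)) • resolventOp A (l ^ (α : ℂ))) := by
  obtain ⟨C, hC0, hC⟩ := exists_norm_resolventOp_le hA hP hα0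
  have h := hankelIntegrable_exp_smul
    (F := fun l => l ^ ((α : ℂ) - 1) • resolventOp A (l ^ (α : ℂ)))
    (β := 1) (C := C) hP.r_pos hP.lt_delta hP.delta_lt
    ((differentiableOn_cpow hP _).continuousOn.smul
      (differentiableOn_resolventOp hA hP hα0).continuousOn) (fun l hl => ?_) ht
  · simpa only [smul_smul] using h
  · have hl0 : 0 < ‖l‖ := hP.r_pos.trans_le hl.1
    rw [norm_smul, show (-1 : ℝ) = -(1 - α) + -α by ring, Real.rpow_add hl0, mul_left_comm]
    exact mul_le_mul (norm_cpow_sub_one_le α l) (hC l hl) (norm_nonneg _) (by positivity)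

theorem solOp_apply [CompleteSpace X] (hA : IsSectorial A M θ α μ)
    (hP : IsHankelPath θ α μ r δ) (hα0 : 0 < α)
    {t : ℝ} (ht : 0 < t) (y : X) : solOp A α r δ t y = (2 * (Real.pi : ℂ) * I)⁻¹ •
      hankelIntegral r δ (fun l =>
        (exp (l * t) * l ^ ((α : ℂ) - 1)) • resolventOp A (l ^ (α : ℂ)) y) := by
  have h := (hankelIntegrable_exp_cpow_smul_resolventOp hA hP hα0 ht).hankelIntegral_clm_apply
    hP.r_pos (ContinuousLinearMap.apply ℂ X y)
  simp only [ContinuousLinearMap.apply_apply, smul_apply] at h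
  rw [h, solOp, if_neg ht.ne', smul_apply]

/-- Subtracting Hankel's integral for the constant `1` from the definition of `S_α(t)` gains a
factor `λ ^ (-α) A`, that is, decay of the integrand on the domain of `A`. -/
theorem solOp_eq_add_symbolOp [CompleteSpace X] (hA : IsSectorial A M θ α μ)
    (hP : IsHankelPath θ α μ r δ)
    (hα0 : 0 < α) {t : ℝ} (ht : 0 < t) (y : X) :
    solOp A α r δ t y = y + symbolOp A α r δ (fun l => l⁻¹) y t := by
  have hr := hP.r_pos
  have h1 : HankelIntegrable r δ (fun l : ℂ => exp (l * t) • l⁻¹) := by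
    refine hankelIntegrable_exp_smul (C := 1) (β := 1) hr hP.lt_delta hP.delta_lt
      (continuousOn_inv₀.mono fun l hl => ne_zero_of_mem_hankelRegion hr hl) (fun l _ => ?_) ht
    rw [one_mul]
    exact norm_inv_le_rpow l
  set L := ContinuousLinearMap.toSpanSingleton ℂ y
  have h2 := h1.hankelIntegral_clm_apply hr L
  rw [hankelIntegral_exp_smul_inv hr hP.lt_delta hP.delta_lt ht] at h2
  have h3 := (hankelIntegrable_exp_cpow_smul_resolventOp hA hP hα0 ht).clm_apply
    (ContinuousLinearMap.apply ℂ X y)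
  have h4 := h3.hankelIntegral_sub hr (h1.clm_apply L)
  rw [h2] at h4
  have h5 : symbolOp A α r δ (fun l => l⁻¹) y t = solOp A α r δ t y - y := by
    rw [solOp_apply hA hP hα0 ht, symbolOp]
    have e : y = (2 * (Real.pi : ℂ) * I)⁻¹ • L (2 * (Real.pi : ℂ) * I) := by
      rw [ContinuousLinearMap.toSpanSingleton_apply, smul_smul,
        inv_mul_cancel₀ two_pi_I_ne_zero, one_smul]
    conv_rhs => rw [e]
    rw [← smul_sub]
    simp only [ContinuousLinearMap.apply_apply, smul_apply] at h4
    congr 1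
    rw [← e, ← h4]
    refine hankelIntegral_congr hr hP.delta_pos hP.delta_lt fun l hl => ?_
    have hl0 := ne_zero_of_mem_hankelRegion hr hl
    simp only [L, ContinuousLinearMap.toSpanSingleton_apply, aResolvent_apply, smul_sub, smul_smul,
      cpow_sub _ _ hl0, cpow_one, smul_eq_mul]
    congr 2
    field_simp
  rw [h5, add_sub_cancel]

/-- `S_α(t) y` lies in the domain of `A`, as `S_α(t) y = R(z, A) w` for some `w`. -/
theorem apply_solOp [CompleteSpace X] (hA : IsSectorial A M θ α μ)
    (hP : IsHankelPath θ α μ r δ) (hα0 : 0 < α)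
    {t : ℝ} (ht : 0 < t) (y : X) : ∃ h : solOp A α r δ t y ∈ A.domain,
      A ⟨solOp A α r δ t y, h⟩ = symbolOp A α r δ (fun l => l ^ ((α : ℂ) - 1)) y t := by
  have hr := hP.r_pos
  have hmem : (r : ℂ) ∈ hankelRegion r δ := by
    have h := mem_hankelRegion hr hP.delta_lt (φ := 0) le_rfl (by simpa using hP.delta_pos.le)
    simpa using h
  set z : ℂ := (r : ℂ) ^ (α : ℂ)
  have hz : z ∈ resolventSet A := hP.cpow_mem_resolventSet hA hmem
  have h1 := hankelIntegrable_symbol (m := fun l => l ^ ((α : ℂ) - 1)) hA hP hα0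
    (differentiableOn_cpow hP _).continuousOn
    (fun l _ => norm_cpow_sub_one_le α l) y ht
  have h2 := (hankelIntegrable_exp_cpow_smul_resolventOp hA hP hα0 ht).clm_apply
    (z • ContinuousLinearMap.apply ℂ X y)
  have h2' := (hankelIntegrable_exp_cpow_smul_resolventOp hA hP hα0 ht).hankelIntegral_clm_apply
    hr (z • ContinuousLinearMap.apply ℂ X y)
  have h3 := h2.sub h1
  set w : X := z • solOp A α r δ t y - symbolOp A α r δ (fun l => l ^ ((α : ℂ) - 1)) y t with hw
  have hwI : w = (2 * (Real.pi : ℂ) * I)⁻¹ • hankelIntegral r δ (fun l =>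
      (z • ContinuousLinearMap.apply ℂ X y)
        ((exp (l * t) * l ^ ((α : ℂ) - 1)) • resolventOp A (l ^ (α : ℂ)))
      - exp (l * t) • l ^ ((α : ℂ) - 1) • aResolvent A α l y) := by
    rw [h2.hankelIntegral_sub hr h1, h2', hw, smul_sub, symbolOp, solOp, if_neg ht.ne']
    simp only [smul_apply, ContinuousLinearMap.apply_apply]
    rw [smul_comm z]
  have hRw : resolventOp A z w = solOp A α r δ t y := by
    rw [hwI, map_smul, ← h3.hankelIntegral_clm_apply hr, solOp_apply hA hP hα0 ht]
    congr 1
    refine hankelIntegral_congr hr hP.delta_pos hP.delta_lt fun l hl => ?_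
    have hlr := hP.cpow_mem_resolventSet hA hl
    have h := DFunLike.congr_fun (resolventOp_sub hz hlr) y
    simp only [sub_apply, smul_apply, mul_apply_eq_comp] at h
    simp only [smul_apply, ContinuousLinearMap.apply_apply, map_sub, map_smul, aResolvent_apply]
    have h' : resolventOp A z y = resolventOp A (l ^ (α : ℂ)) y
        + (l ^ (α : ℂ) - z) • resolventOp A z (resolventOp A (l ^ (α : ℂ)) y) := by
      rw [← h]; abel
    rw [h']
    module
  have hdom := resolventOp_mem hz w
  have happ := apply_resolventOp hz w
  simp only [hRw] at hdom happ
  exact ⟨hdom, by rw [happ, hw, sub_sub_cancel]⟩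

end Solution

/-! ### Convolutions with a weakly singular kernel on the real line -/

section RealConvolution
open MeasureTheory Set Filter
variable {E : Type*} [NormedAddCommGroup E] [NormedSpace ℝ E] {α β t : ℝ}

theorem intervalIntegrable_sub_rpow_mul_rpow (hα : α < 1) (hβ : 0 < β) (ht : 0 < t) :
    IntervalIntegrable (fun s : ℝ => (t - s) ^ (-α) * s ^ (β - 1)) volume 0 t := by
  have h1 : IntervalIntegrable (fun s : ℝ => (t - s) ^ (-α) * s ^ (β - 1)) volume 0 (t / 2) := by
    refine IntervalIntegrable.continuousOn_mul
      (intervalIntegral.intervalIntegrable_rpow' (by linarith)) ?_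
    refine ContinuousOn.rpow_const (by fun_prop) fun s hs => Or.inl ?_
    rw [uIcc_of_le (by linarith)] at hs
    linarith [hs.2]
  have h2 : IntervalIntegrable (fun s : ℝ => (t - s) ^ (-α) * s ^ (β - 1)) volume (t / 2) t := by
    refine IntervalIntegrable.mul_continuousOn (intervalIntegrable_sub_rpow_neg hα _ _ _) ?_
    refine ContinuousOn.rpow_const (by fun_prop) fun s hs => Or.inl ?_
    rw [uIcc_of_le (by linarith)] at hs
    linarith [hs.1]
  exact h1.trans h2

theorem intervalIntegrable_sub_rpow_smul (hα : α < 1) (hβ : 0 < β) (ht : 0 < t) {w : ℝ → E}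
    (hw : ContinuousOn w (Ioi 0)) {C : ℝ}
    (hC : ∀ s, 0 < s → s ≤ t → ‖w s‖ ≤ C * s ^ (β - 1)) :
    IntervalIntegrable (fun s => (t - s) ^ (-α) • w s) volume 0 t := by
  refine ((intervalIntegrable_sub_rpow_mul_rpow hα hβ ht).const_mul C).mono_fun' ?_ ?_
  · rw [uIoc_of_le ht.le]
    refine AEStronglyMeasurable.smul ?_ ?_
    · exact (Measurable.pow_const (by fun_prop) _).aestronglyMeasurable
    · exact (hw.mono Ioc_subset_Ioi_self).aestronglyMeasurable measurableSet_Ioc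
  · rw [uIoc_of_le ht.le]
    refine (ae_restrict_iff' measurableSet_Ioc).2 (Eventually.of_forall fun s hs => ?_)
    have h0 : 0 ≤ t - s := by linarith [hs.2]
    change ‖(t - s) ^ (-α) • w s‖ ≤ C * ((t - s) ^ (-α) * s ^ (β - 1))
    rw [norm_smul, Real.norm_of_nonneg (by positivity), mul_left_comm]
    gcongr
    exact hC s hs.1 hs.2

theorem intervalIntegrable_sub_rpow_smul_of_bounded (hα : α < 1) (ht : 0 < t) {w : ℝ → E}
    (hw : ContinuousOn w (Ioi 0)) {C : ℝ} (hC : ∀ s, 0 < s → s ≤ t → ‖w s‖ ≤ C) :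
    IntervalIntegrable (fun s => (t - s) ^ (-α) • w s) volume 0 t := by
  refine intervalIntegrable_sub_rpow_smul hα one_pos ht hw (C := C) fun s hs hst => ?_
  rw [sub_self, Real.rpow_zero, mul_one]
  exact hC s hs hst

/-- The scaling `s = τ x` turns a convolution on `[0, τ]` into an integral over `[0, 1]`. -/
theorem integral_sub_rpow_smul_eq {τ : ℝ} (hτ : 0 < τ) (w : ℝ → E) :
    ∫ s in (0 : ℝ)..τ, (τ - s) ^ (-α) • w s
      = τ ^ (1 - α) • ∫ x in (0 : ℝ)..1, (1 - x) ^ (-α) • w (τ * x) := by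
  have h := intervalIntegral.smul_integral_comp_mul_left (a := 0) (b := 1)
    (fun s => (τ - s) ^ (-α) • w s) τ
  rw [mul_zero, mul_one] at h
  rw [← h, ← intervalIntegral.integral_smul, ← intervalIntegral.integral_smul]
  refine intervalIntegral.integral_congr fun x hx => ?_
  rw [uIcc_of_le zero_le_one] at hx
  have e : τ - τ * x = τ * (1 - x) := by ring
  simp only [smul_smul]
  rw [e, Real.mul_rpow hτ.le (by linarith [hx.2]), sub_eq_add_neg 1 α, Real.rpow_add hτ,
    Real.rpow_one, mul_assoc]

theorem tendsto_integral_left {g : ℝ → E} (hg : IntervalIntegrable g volume 0 t) (ht : 0 < t) :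
    Tendsto (fun b => ∫ s in b..t, g s) (𝓝[>] 0) (𝓝 (∫ s in (0 : ℝ)..t, g s)) := by
  have h : ContinuousOn (fun b => ∫ s in b..t, g s) (uIcc 0 t) := by
    simp only [intervalIntegral.integral_symm t]
    exact (intervalIntegral.continuousOn_primitive_interval' hg right_mem_uIcc).neg
  have h0 := h 0 left_mem_uIcc
  rw [uIcc_of_le ht.le] at h0
  have hle : 𝓝[>] (0 : ℝ) ≤ 𝓝[Icc 0 t] 0 := by
    rw [← nhdsWithin_Ioo_eq_nhdsGT ht]
    exact nhdsWithin_mono _ Ioo_subset_Icc_self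
  exact h0.tendsto.mono_left hle

variable [CompleteSpace E]

theorem smul_integral_sub_rpow_smul_deriv (hα : α < 1) {v v' : ℝ → E}
    (hv : ∀ s, 0 < s → HasDerivAt v (v' s) s) (hv'c : ContinuousOn v' (Ioi 0)) {b : ℝ}
    (hb : 0 < b) (hbt : b < t) :
    t • ∫ s in b..t, (t - s) ^ (-α) • v' s
      = -((t - b) ^ (1 - α) • v b) + (1 - α) • (∫ s in b..t, (t - s) ^ (-α) • v s)
        + ∫ s in b..t, (t - s) ^ (-α) • s • v' s := by
  have hsub : uIcc b t ⊆ Ioi 0 := by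
    rw [uIcc_of_le hbt.le]
    exact fun s hs => hb.trans_le hs.1
  have hvc : ContinuousOn v (Ioi 0) := fun s hs => (hv s hs).continuousAt.continuousWithinAt
  have hκ := intervalIntegrable_sub_rpow_neg hα b t t
  have hi1 := hκ.smul_continuousOn (hvc.mono hsub)
  have hi2 : IntervalIntegrable (fun s => (t - s) ^ (-α) • s • v' s) volume b t :=
    hκ.smul_continuousOn (continuousOn_id.smul (hv'c.mono hsub))
  have hα1 : 0 < 1 - α := by linarith
  have hcont : ContinuousOn (fun s : ℝ => (t - s) ^ (1 - α)) (uIcc b t) :=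
    ContinuousOn.rpow_const (by fun_prop) fun s _ => Or.inr hα1.le
  have hi3 := (hv'c.mono hsub).intervalIntegrable.continuousOn_smul (μ := volume) hcont
  have hparts := intervalIntegral.integral_smul_deriv_eq_deriv_smul_of_hasDerivAt
    (u := fun s : ℝ => (t - s) ^ (1 - α)) (u' := fun s => -(1 - α) * (t - s) ^ (-α))
    hcont (hvc.mono hsub) ?_ (fun s hs => hv s ?_) (hκ.const_mul _)
    (hv'c.mono hsub).intervalIntegrable
  · have hsplit : ∀ s ∈ uIcc b t, t • (t - s) ^ (-α) • v' s
        = (t - s) ^ (1 - α) • v' s + (t - s) ^ (-α) • s • v' s := by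
      intro s hs
      rw [uIcc_of_le hbt.le] at hs
      rw [smul_smul, smul_smul, ← add_smul]
      rcases hs.2.eq_or_lt with rfl | hst
      · rw [sub_self, Real.zero_rpow hα1.ne', zero_add, mul_comm]
      · have h0 : 0 < t - s := by linarith
        rw [sub_eq_add_neg 1 α, Real.rpow_add h0, Real.rpow_one]
        congr 1
        ring
    rw [← intervalIntegral.integral_smul, intervalIntegral.integral_congr hsplit,
      intervalIntegral.integral_add hi3 hi2, hparts, sub_self, Real.zero_rpow hα1.ne', zero_smul,
      zero_sub]
    simp only [mul_smul, intervalIntegral.integral_smul]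
    rw [neg_smul, sub_neg_eq_add]
  · intro s hs
    rw [max_eq_right hbt.le] at hs
    have h0 : t - s ≠ 0 := by linarith [hs.2]
    have h := ((hasDerivAt_id s).const_sub t).rpow_const (p := 1 - α) (Or.inl h0)
    refine h.congr_deriv ?_
    rw [show 1 - α - 1 = -α by ring, id_eq]
    ring
  · rw [min_eq_left hbt.le] at hs
    exact hb.trans hs.1

/-- If the convolution of `v` with `s ^ (-α)` has derivative `L` at `t`, then `L` is also the
improper convolution of `v'` with `s ^ (-α)`, provided that `v` vanishes at `0` and `s v'(s)` is
bounded. Differentiating in the scaled form of the convolution produces only the integrable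
function `s v'(s)`; the term `(t - s) v'(s)` which is missing from `t v'(s)` is integrated
by parts. -/
theorem tendsto_integral_sub_rpow_smul_deriv (hα : α < 1) (ht : 0 < t) {v v' : ℝ → E} {L : E}
    (hv : ∀ s, 0 < s → HasDerivAt v (v' s) s) (hv'c : ContinuousOn v' (Ioi 0)) {C C' : ℝ}
    (hC : ∀ s, 0 < s → s ≤ 2 * t → ‖v s‖ ≤ C) (hC' : ∀ s, 0 < s → s ≤ 2 * t → s * ‖v' s‖ ≤ C')
    (hv0 : Tendsto v (𝓝[>] 0) (𝓝 0))
    (hL : HasDerivAt (fun τ => ∫ s in (0 : ℝ)..τ, (τ - s) ^ (-α) • v s) L t) :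
    Tendsto (fun b => ∫ s in b..t, (t - s) ^ (-α) • v' s) (𝓝[>] 0) (𝓝 L) := by
  have hvc : ContinuousOn v (Ioi 0) := fun s hs => (hv s hs).continuousAt.continuousWithinAt
  have hi1 := intervalIntegrable_sub_rpow_smul_of_bounded hα ht hvc
    (fun s hs hst => hC s hs (by linarith))
  have hi2 := intervalIntegrable_sub_rpow_smul_of_bounded (w := fun s => s • v' s) hα ht
    (continuousOn_id.smul hv'c) (C := C') (fun s hs hst => by
      rw [norm_smul, Real.norm_of_nonneg hs.le]
      exact hC' s hs (by linarith))
  have hscale : ∀ τ : ℝ, 0 < τ → MapsTo (fun x : ℝ => τ * x) (Ioi 0) (Ioi 0) :=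
    fun τ hτ x hx => mul_pos hτ hx
  have hC0 : 0 ≤ C' := (mul_nonneg ht.le (norm_nonneg _)).trans (hC' t ht (by linarith))
  -- differentiation of the scaled form of the convolution
  have hscaled : HasDerivAt (fun τ => ∫ x in (0 : ℝ)..1, (1 - x) ^ (-α) • v (τ * x))
      (∫ x in (0 : ℝ)..1, (1 - x) ^ (-α) • x • v' (t * x)) t := by
    have hnhds : Ioo (t / 2) (2 * t) ∈ 𝓝 t := Ioo_mem_nhds (by linarith) (by linarith)
    have hκ := intervalIntegrable_sub_rpow_neg hα 0 1 1
    have hmeas : ∀ w : ℝ → E, ContinuousOn w (Ioi 0) →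
        AEStronglyMeasurable (fun x : ℝ => (1 - x) ^ (-α) • w x)
          (volume.restrict (uIoc 0 1)) := by
      intro w hw
      rw [uIoc_of_le zero_le_one]
      refine AEStronglyMeasurable.smul ?_ ?_
      · exact (Measurable.pow_const (by fun_prop) _).aestronglyMeasurable
      · exact (hw.mono Ioc_subset_Ioi_self).aestronglyMeasurable measurableSet_Ioc
    refine (intervalIntegral.hasDerivAt_integral_of_dominated_loc_of_deriv_le (𝕜 := ℝ) hnhds
      (F' := fun τ x => (1 - x) ^ (-α) • x • v' (τ * x))
      (bound := fun x => (1 - x) ^ (-α) * (C' * (2 / t))) ?_ ?_ ?_ ?_ (hκ.mul_const _) ?_).2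
    · filter_upwards [lt_mem_nhds ht] with τ hτ
      exact hmeas _ (hvc.comp (by fun_prop) (hscale τ hτ))
    · refine intervalIntegrable_sub_rpow_smul_of_bounded (w := fun x => v (t * x)) hα one_pos
        (hvc.comp (by fun_prop) (hscale t ht)) (C := C) fun x hx hx1 => hC _ (mul_pos ht hx) ?_
      nlinarith
    · refine hmeas (fun x => x • v' (t * x)) (continuousOn_id.smul ?_)
      exact hv'c.comp (by fun_prop) (hscale t ht)
    · refine Eventually.of_forall fun x hx τ hτ => ?_
      rw [uIoc_of_le zero_le_one] at hx
      have hτ0 : 0 < τ := by linarith [hτ.1]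
      have h1 := hC' (τ * x) (mul_pos hτ0 hx.1) (by nlinarith [hx.2, hx.1, hτ.2])
      have h2 : x * ‖v' (τ * x)‖ ≤ C' * (2 / t) := by
        have h3 : x * ‖v' (τ * x)‖ = (τ * x * ‖v' (τ * x)‖) / τ := by field_simp
        rw [h3, div_le_iff₀ hτ0]
        refine h1.trans ?_
        rw [mul_assoc]
        refine le_mul_of_one_le_right hC0 ?_
        rw [div_mul_eq_mul_div, one_le_div ht]
        linarith [hτ.1]
      have h4 : 0 ≤ 1 - x := by linarith [hx.2]
      rw [norm_smul, norm_smul, Real.norm_of_nonneg (by positivity), Real.norm_of_nonneg hx.1.le]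
      gcongr
    · refine Eventually.of_forall fun x hx τ hτ => ?_
      rw [uIoc_of_le zero_le_one] at hx
      have hτ0 : 0 < τ := by linarith [hτ.1]
      have h1 : HasDerivAt (fun τ : ℝ => τ * x) x τ := by
        simpa using (hasDerivAt_id τ).mul_const x
      exact ((hv _ (mul_pos hτ0 hx.1)).scomp τ h1).const_smul _
  have hprod := ((hasDerivAt_id t).rpow_const (p := 1 - α) (Or.inl ht.ne')).smul hscaled
  have hΦ := hprod.congr_of_eventuallyEq
    (f₁ := fun τ => ∫ s in (0 : ℝ)..τ, (τ - s) ^ (-α) • v s) (by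
    filter_upwards [lt_mem_nhds ht] with τ hτ using integral_sub_rpow_smul_eq hτ v)
  have hLt : t • L = (1 - α) • (∫ s in (0 : ℝ)..t, (t - s) ^ (-α) • v s)
      + ∫ s in (0 : ℝ)..t, (t - s) ^ (-α) • s • v' s := by
    rw [hL.unique hΦ, integral_sub_rpow_smul_eq ht v,
      integral_sub_rpow_smul_eq ht (fun s => s • v' s)]
    simp only [id_eq, mul_smul]
    have e : ∫ x in (0 : ℝ)..1, (1 - x) ^ (-α) • t • x • v' (t * x)
        = t • ∫ x in (0 : ℝ)..1, (1 - x) ^ (-α) • x • v' (t * x) := by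
      rw [← intervalIntegral.integral_smul]
      refine intervalIntegral.integral_congr fun x _ => ?_
      rw [smul_comm]
    rw [e, Real.rpow_sub_one ht.ne', smul_add, add_comm]
    simp only [smul_smul]
    congr 2
    · field_simp
    · ring
  have hα1 : 0 < 1 - α := by linarith
  have hbdry : Tendsto (fun b : ℝ => -((t - b) ^ (1 - α) • v b)) (𝓝[>] 0) (𝓝 0) := by
    have h1 : Tendsto (fun b : ℝ => (t - b) ^ (1 - α)) (𝓝[>] 0) (𝓝 ((t - 0) ^ (1 - α))) := by
      refine Tendsto.mono_left (Continuous.tendsto ?_ 0) nhdsWithin_le_nhds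
      exact Continuous.rpow_const (by fun_prop) fun s => Or.inr hα1.le
    simpa using (h1.smul hv0).neg
  have hlim := (hbdry.add ((tendsto_integral_left hi1 ht).const_smul (1 - α))).add
    (tendsto_integral_left hi2 ht)
  rw [zero_add, ← hLt] at hlim
  have hlim' := hlim.const_smul t⁻¹
  rw [smul_smul, inv_mul_cancel₀ ht.ne', one_smul] at hlim'
  refine hlim'.congr' ?_
  filter_upwards [Ioo_mem_nhdsGT ht] with b hb
  rw [← smul_integral_sub_rpow_smul_deriv hα hv hv'c hb.1 hb.2, smul_smul,
    inv_mul_cancel₀ ht.ne', one_smul]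

end RealConvolution

/-! ### Caputo derivatives of the solution operators -/

section Caputo
open Complex MeasureTheory Set Filter
variable {X : Type*} [NormedAddCommGroup X] [NormedSpace ℂ X]
  {A : X →ₗ.[ℂ] X} {M θ α μ r δ : ℝ}

/-- If `α δ < π / 2`, then `λ ^ α` stays in the half-plane `Re > μ` for large `|λ|`. -/
theorem exists_isHankelPath (hθ : θ < Real.pi / 2) (hα0 : 0 < α) (hα1 : α < 1) (μ : ℝ) :
    ∃ r δ : ℝ, IsHankelPath θ α μ r δ := by
  have hpi := Real.pi_pos
  have h1 : Real.pi / 2 < min Real.pi (Real.pi / 2 / α) := by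
    refine lt_min (by linarith) ?_
    rw [lt_div_iff₀ hα0]
    nlinarith
  obtain ⟨δ, hδ1, hδ2⟩ := exists_between h1
  have hδα : δ * α < Real.pi / 2 := (lt_div_iff₀ hα0).1 (hδ2.trans_le (min_le_right _ _))
  have hδ0 : 0 < δ * α := mul_pos (by linarith) hα0
  have hcos : 0 < Real.cos (δ * α) := Real.cos_pos_of_mem_Ioo ⟨by linarith, hδα⟩
  refine ⟨((|μ| + 1) / Real.cos (δ * α)) ^ α⁻¹, δ, by positivity, hδ1,
    hδ2.trans_le (min_le_left _ _), fun l hl harg hmem => ?_⟩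
  have h2 : (|μ| + 1) / Real.cos (δ * α) ≤ ‖l‖ ^ α := by
    have h3 := Real.rpow_le_rpow (by positivity) hl hα0.le
    rwa [Real.rpow_inv_rpow (by positivity) hα0.ne'] at h3
  have h4 : Real.cos (δ * α) ≤ Real.cos (arg l * α) := by
    rw [← Real.cos_abs (arg l * α), abs_mul, abs_of_pos hα0]
    exact Real.cos_le_cos_of_nonneg_of_le_pi (by positivity) (by linarith) (by gcongr)
  have h5 : |μ| + 1 ≤ (l ^ (α : ℂ)).re := by
    rw [cpow_ofReal_re]
    rw [div_le_iff₀ hcos] at h2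
    exact h2.trans (by gcongr)
  have h6 : |arg (-(l ^ (α : ℂ) - (μ : ℂ)))| ≤ Real.pi / 2 := (le_of_lt hmem).trans hθ.le
  rw [abs_arg_le_pi_div_two_iff, neg_re, sub_re, ofReal_re] at h6
  linarith [le_abs_self μ]

theorem exists_norm_symbolOp_le (hA : IsSectorial A M θ α μ) (hP : IsHankelPath θ α μ r δ)
    (hα0 : 0 < α) {m : ℂ → ℂ} {β γ : ℝ} (hm : DifferentiableOn ℂ m (hankelRegion r δ))
    (hmβ : ∀ l ∈ hankelRegion r δ, ‖m l‖ ≤ ‖l‖ ^ (-β)) (hβγ : 0 ≤ β + γ) (T : ℝ) :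
    ∃ K : ℝ, 0 ≤ K ∧ ∀ (y : X) (C : ℝ),
      (∀ l ∈ hankelRegion r δ, ‖aResolvent A α l y‖ ≤ C * ‖l‖ ^ (-γ)) →
      ∀ t, 0 < t → t ≤ T → ‖symbolOp A α r δ m y t‖ ≤ K * C * t ^ (β + γ - 1) := by
  obtain ⟨K, hK0, hK⟩ := exists_norm_hankelIntegral_exp_le (E := X) hP.r_pos hP.lt_delta
    hP.delta_lt hβγ T
  refine ⟨‖(2 * (Real.pi : ℂ) * I)⁻¹‖ * K, by positivity, fun y C hC t ht htT => ?_⟩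
  have h := hK (fun l => m l • aResolvent A α l y) C
    (hm.smul (differentiableOn_aResolvent_apply hA hP hα0 y))
    (norm_smul_aResolvent_le hP.r_pos hmβ hC) t ht htT
  rw [symbolOp, norm_smul, mul_assoc _ K, mul_assoc _ (K * C)]
  gcongr

theorem differentiableOn_inv_hankelRegion (hr : 0 < r) :
    DifferentiableOn ℂ (fun l : ℂ => l⁻¹) (hankelRegion r δ) :=
  differentiableOn_inv.mono fun _ hl => ne_zero_of_mem_hankelRegion hr hl

theorem norm_mul_inv_le (l : ℂ) : ‖l * l⁻¹‖ ≤ ‖l‖ ^ (-(0 : ℝ)) := by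
  rw [neg_zero, Real.rpow_zero, norm_mul, norm_inv]
  exact mul_inv_le_one

theorem continuousOn_cpow_mul_inv (hP : IsHankelPath θ α μ r δ) :
    ContinuousOn (fun l : ℂ => l ^ ((α : ℂ) - 1) * l⁻¹) (hankelRegion r δ) :=
  (differentiableOn_cpow hP _).continuousOn.mul
    (differentiableOn_inv_hankelRegion hP.r_pos).continuousOn

theorem norm_cpow_mul_inv_le (hr : 0 < r) {l : ℂ} (hl : l ∈ hankelRegion r δ) :
    ‖l ^ ((α : ℂ) - 1) * l⁻¹‖ ≤ ‖l‖ ^ (-((1 - α) + 1)) := by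
  have hl0 : 0 < ‖l‖ := hr.trans_le hl.1
  rw [norm_mul, neg_add, Real.rpow_add hl0]
  gcongr
  · exact norm_cpow_sub_one_le α l
  · exact norm_inv_le_rpow l

/-- The orbit `t ↦ S_α(t) y - y`, for `t > 0`. -/
noncomputable def orbitSub (A : X →ₗ.[ℂ] X) (α r δ : ℝ) (y : X) : ℝ → X :=
  symbolOp A α r δ (fun l => l⁻¹) y

/-- The derivative of the orbit. -/
noncomputable def orbitDeriv (A : X →ₗ.[ℂ] X) (α r δ : ℝ) (y : X) : ℝ → X :=
  symbolOp A α r δ (fun l => l * l⁻¹) y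

theorem hasDerivAt_orbitSub (hA : IsSectorial A M θ α μ) (hP : IsHankelPath θ α μ r δ)
    (hα0 : 0 < α) (y : X) (s : ℝ) (hs : 0 < s) :
    HasDerivAt (orbitSub A α r δ y) (orbitDeriv A α r δ y s) s :=
  hasDerivAt_symbolOp hA hP hα0 (differentiableOn_inv_hankelRegion hP.r_pos).continuousOn
    (fun l _ => norm_inv_le_rpow l) y hs

theorem continuousOn_orbitSub (hA : IsSectorial A M θ α μ) (hP : IsHankelPath θ α μ r δ)
    (hα0 : 0 < α) (y : X) : ContinuousOn (orbitSub A α r δ y) (Ioi 0) := fun s hs =>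
  (hasDerivAt_orbitSub hA hP hα0 y s hs).continuousAt.continuousWithinAt

theorem continuousOn_orbitDeriv (hA : IsSectorial A M θ α μ) (hP : IsHankelPath θ α μ r δ)
    (hα0 : 0 < α) (y : X) : ContinuousOn (orbitDeriv A α r δ y) (Ioi 0) := fun _ hs =>
  (hasDerivAt_symbolOp hA hP hα0
    (differentiableOn_id.mul (differentiableOn_inv_hankelRegion hP.r_pos)).continuousOn
    (fun l _ => norm_mul_inv_le l) y hs).continuousAt.continuousWithinAt

theorem exists_norm_orbitSub_le (hA : IsSectorial A M θ α μ) (hP : IsHankelPath θ α μ r δ)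
    (hα0 : 0 < α) (T : ℝ) : ∃ K : ℝ, 0 ≤ K ∧ ∀ (y : X) (t : ℝ), 0 < t → t ≤ T →
      ‖orbitSub A α r δ y t‖ ≤ K * ‖y‖ := by
  obtain ⟨C, hC0, hC⟩ := exists_norm_aResolvent_le hA hP hα0
  obtain ⟨K, hK0, hK⟩ := exists_norm_symbolOp_le (γ := 0) hA hP hα0
    (differentiableOn_inv_hankelRegion hP.r_pos) (fun l _ => norm_inv_le_rpow l) (by norm_num) T
  refine ⟨K * C, by positivity, fun y t ht htT => ?_⟩
  have h := hK y (C * ‖y‖)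
    (fun l hl => by rw [neg_zero, Real.rpow_zero, mul_one]; exact hC l hl y) t ht htT
  rwa [add_zero, sub_self, Real.rpow_zero, mul_one, ← mul_assoc] at h

theorem exists_mul_norm_orbitDeriv_le (hA : IsSectorial A M θ α μ)
    (hP : IsHankelPath θ α μ r δ) (hα0 : 0 < α) (y : X) (T : ℝ) : ∃ K : ℝ, ∀ t : ℝ, 0 < t →
      t ≤ T → t * ‖orbitDeriv A α r δ y t‖ ≤ K := by
  obtain ⟨C, hC0, hC⟩ := exists_norm_aResolvent_le hA hP hα0
  obtain ⟨K, hK0, hK⟩ := exists_norm_symbolOp_le (γ := 0) hA hP hα0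
    (differentiableOn_id.mul (differentiableOn_inv_hankelRegion hP.r_pos))
    (fun l _ => norm_mul_inv_le l) (by norm_num) T
  refine ⟨K * (C * ‖y‖), fun t ht htT => ?_⟩
  have h := hK y (C * ‖y‖)
    (fun l hl => by rw [neg_zero, Real.rpow_zero, mul_one]; exact hC l hl y) t ht htT
  rw [add_zero, zero_sub, Real.rpow_neg_one, ← div_eq_mul_inv, le_div_iff₀ ht] at h
  rwa [mul_comm]

theorem exists_norm_orbit_le_of_mem (hA : IsSectorial A M θ α μ) (hP : IsHankelPath θ α μ r δ)
    (hα0 : 0 < α) {y : X} (hy : y ∈ A.domain) (T : ℝ) : ∃ K : ℝ, ∀ t : ℝ, 0 < t → t ≤ T →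
      ‖orbitSub A α r δ y t‖ ≤ K * t ^ α ∧ ‖orbitDeriv A α r δ y t‖ ≤ K * t ^ (α - 1) := by
  obtain ⟨C, hC0, hC⟩ := exists_norm_aResolvent_le_of_mem hA hP hα0 hy
  obtain ⟨K, hK0, hK⟩ := exists_norm_symbolOp_le (γ := α) hA hP hα0
    (differentiableOn_inv_hankelRegion hP.r_pos) (fun l _ => norm_inv_le_rpow l) (by linarith) T
  obtain ⟨K', hK'0, hK'⟩ := exists_norm_symbolOp_le (γ := α) hA hP hα0
    (differentiableOn_id.mul (differentiableOn_inv_hankelRegion hP.r_pos))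
    (fun l _ => norm_mul_inv_le l) (by linarith) T
  refine ⟨max (K * C) (K' * C), fun t ht htT => ⟨?_, ?_⟩⟩
  · have h := hK y C hC t ht htT
    rw [add_sub_cancel_left] at h
    exact h.trans (by gcongr; exact le_max_left _ _)
  · have h := hK' y C hC t ht htT
    rw [zero_add] at h
    exact h.trans (by gcongr; exact le_max_right _ _)

theorem orbitSub_sub (hA : IsSectorial A M θ α μ) (hP : IsHankelPath θ α μ r δ)
    (hα0 : 0 < α) (y z : X) {t : ℝ} (ht : 0 < t) :
    orbitSub A α r δ (y - z) t = orbitSub A α r δ y t - orbitSub A α r δ z t := by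
  have hc := (differentiableOn_inv_hankelRegion (δ := δ) hP.r_pos).continuousOn
  have hb : ∀ l ∈ hankelRegion r δ, ‖l⁻¹‖ ≤ ‖l‖ ^ (-(1 : ℝ)) := fun l _ => norm_inv_le_rpow l
  simp only [orbitSub, symbolOp]
  rw [← smul_sub, ← (hankelIntegrable_symbol hA hP hα0 hc hb y ht).hankelIntegral_sub hP.r_pos
    (hankelIntegrable_symbol hA hP hα0 hc hb z ht)]
  simp only [map_sub, smul_sub]

/-- Strong continuity at `0` on the closure of the domain. -/
theorem tendsto_orbitSub (hA : IsSectorial A M θ α μ) (hP : IsHankelPath θ α μ r δ)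
    (hα0 : 0 < α) {y : X} (hy : y ∈ closure (A.domain : Set X)) :
    Tendsto (orbitSub A α r δ y) (𝓝[>] 0) (𝓝 0) := by
  obtain ⟨K, hK0, hK⟩ := exists_norm_orbitSub_le (A := A) hA hP hα0 1
  rw [Metric.tendsto_nhds]
  intro ε hε
  obtain ⟨z, hz, hyz⟩ := Metric.mem_closure_iff.1 hy (ε / 2 / (K + 1)) (by positivity)
  obtain ⟨B, hB⟩ := exists_norm_orbit_le_of_mem hA hP hα0 hz 1
  have hlim : Tendsto (fun t : ℝ => B * t ^ α) (𝓝[>] 0) (𝓝 0) := by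
    have h : Continuous (fun t : ℝ => B * t ^ α) :=
      continuous_const.mul (continuous_id.rpow_const fun _ => Or.inr hα0.le)
    have h' := h.tendsto 0
    rw [Real.zero_rpow hα0.ne', mul_zero] at h'
    exact h'.mono_left nhdsWithin_le_nhds
  filter_upwards [hlim.eventually (gt_mem_nhds (half_pos hε)), Ioc_mem_nhdsGT one_pos]
    with t ht ht1
  rw [dist_zero_right]
  have h1 := (hB t ht1.1 ht1.2).1
  have h2 := hK (y - z) t ht1.1 ht1.2
  rw [orbitSub_sub hA hP hα0 y z ht1.1] at h2
  rw [dist_eq_norm, lt_div_iff₀ (by positivity)] at hyz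
  have h3 : K * ‖y - z‖ ≤ ε / 2 := by nlinarith [norm_nonneg (y - z)]
  have h4 := norm_le_norm_sub_add (orbitSub A α r δ y t) (orbitSub A α r δ z t)
  linarith

variable [CompleteSpace X]

/-- Convolution of `S_α(t) y - y` with `s ^ (-α)`. For `y` in the domain the integrand over the
Hankel path decays like `|λ| ^ (-1 - α)`. The general case follows by applying the resolvent, which
is injective, maps into the domain, and commutes with both sides. -/
theorem integral_sub_rpow_smul_orbitSub (hA : IsSectorial A M θ α μ)
    (hP : IsHankelPath θ α μ r δ) (hα0 : 0 < α) (hα1 : α < 1) (y : X) {τ : ℝ} (hτ : 0 < τ) :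
    ∫ s in (0 : ℝ)..τ, (τ - s) ^ (-α) • orbitSub A α r δ y s
      = Real.Gamma (1 - α) • symbolOp A α r δ (fun l => l ^ ((α : ℂ) - 1) * l⁻¹) y τ := by
  have hr := hP.r_pos
  have hinv := differentiableOn_inv_hankelRegion (δ := δ) hr
  have hmem : ∀ y ∈ A.domain, ∫ s in (0 : ℝ)..τ, (τ - s) ^ (-α) • orbitSub A α r δ y s
      = Real.Gamma (1 - α) • symbolOp A α r δ (fun l => l ^ ((α : ℂ) - 1) * l⁻¹) y τ := by
    intro y hy
    obtain ⟨C, hC0, hC⟩ := exists_norm_aResolvent_le_of_mem hA hP hα0 hy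
    have h := integral_sub_rpow_smul_hankelIntegral (q := 1 + α)
      (F := fun l => l⁻¹ • aResolvent A α l y) hα0.le hα1 hr hP.lt_delta
      hP.delta_lt (hinv.smul (differentiableOn_aResolvent_apply hA hP hα0 y)) (by linarith)
      (norm_smul_aResolvent_le hr (fun l _ => norm_inv_le_rpow l) hC) hτ
    have hint : HankelIntegrable r δ
        (fun l => exp (l * τ) • l ^ ((α : ℂ) - 1) • l⁻¹ • aResolvent A α l y) := by
      have := hankelIntegrable_symbol hA hP hα0 (continuousOn_cpow_mul_inv hP)
        (fun l hl => norm_cpow_mul_inv_le hr hl) y hτ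
      simpa only [mul_smul] using this
    have hclm := hint.hankelIntegral_clm_apply hr
      ((Real.Gamma (1 - α) : ℂ) • ContinuousLinearMap.id ℂ X)
    simp only [smul_apply, ContinuousLinearMap.id_apply] at hclm
    rw [hclm] at h
    simp only [orbitSub, symbolOp, mul_smul]
    rw [← coe_smul, smul_comm (Real.Gamma (1 - α) : ℂ), ← h, ← intervalIntegral.integral_smul]
    refine intervalIntegral.integral_congr fun s _ => ?_
    rw [smul_comm]
  have hzmem : (r : ℂ) ∈ hankelRegion r δ := by
    have h := mem_hankelRegion hr hP.delta_lt (φ := 0) le_rfl (by simpa using hP.delta_pos.le)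
    simpa using h
  have hz := hP.cpow_mem_resolventSet hA hzmem
  obtain ⟨K, hK0, hK⟩ := exists_norm_orbitSub_le (A := A) hA hP hα0 τ
  have hint := intervalIntegrable_sub_rpow_smul_of_bounded hα1 hτ
    (continuousOn_orbitSub hA hP hα0 y) (fun s hs hst => hK y s hs hst)
  refine resolventOp_injective hz ?_
  set R := resolventOp A ((r : ℂ) ^ (α : ℂ))
  rw [← R.intervalIntegral_comp_comm hint, ← coe_smul, map_smul,
    resolventOp_symbolOp hA hP hα0 (continuousOn_cpow_mul_inv hP)
      (fun l hl => norm_cpow_mul_inv_le hr hl) hz y hτ, coe_smul,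
    ← hmem _ (resolventOp_mem hz y)]
  refine intervalIntegral.integral_congr_Ioo_of_le hτ.le fun s hs => ?_
  simp only [orbitSub]
  rw [← coe_smul, map_smul, coe_smul, resolventOp_symbolOp hA hP hα0 hinv.continuousOn
    (fun l _ => norm_inv_le_rpow l) hz y hs.1]

theorem hasDerivAt_integral_sub_rpow_smul_orbitSub (hA : IsSectorial A M θ α μ)
    (hP : IsHankelPath θ α μ r δ) (hα0 : 0 < α) (hα1 : α < 1) (y : X) {t : ℝ} (ht : 0 < t) :
    HasDerivAt (fun τ => ∫ s in (0 : ℝ)..τ, (τ - s) ^ (-α) • orbitSub A α r δ y s)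
      (Real.Gamma (1 - α) • symbolOp A α r δ (fun l => l ^ ((α : ℂ) - 1)) y t) t := by
  have hr := hP.r_pos
  have h := hasDerivAt_symbolOp hA hP hα0 (continuousOn_cpow_mul_inv hP)
    (fun l hl => norm_cpow_mul_inv_le hr hl) y ht
  have e : symbolOp A α r δ (fun l => l * (l ^ ((α : ℂ) - 1) * l⁻¹)) y t
      = symbolOp A α r δ (fun l => l ^ ((α : ℂ) - 1)) y t := by
    rw [symbolOp, symbolOp]
    congr 1
    refine hankelIntegral_congr hr hP.delta_pos hP.delta_lt fun l hl => ?_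
    rw [mul_left_comm, mul_inv_cancel₀ (ne_zero_of_mem_hankelRegion hr hl), mul_one]
  rw [e] at h
  refine (h.const_smul (Real.Gamma (1 - α))).congr_of_eventuallyEq ?_
  filter_upwards [lt_mem_nhds ht] with τ hτ using
    integral_sub_rpow_smul_orbitSub hA hP hα0 hα1 y hτ

end Caputo

section Translation
open MeasureTheory Set Filter
variable {X : Type*} [NormedAddCommGroup X] [NormedSpace ℂ X]
  {α a t : ℝ} {u v v' : ℝ → X} {w : X}

theorem hasRegularizedCaputoDeriv_of_shift (hα : α < 1) (hat : a < t)
    (huv : ∀ s, a < s → u s - u a = v (s - a))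
    (hint : ∀ τ, 0 < τ → IntervalIntegrable (fun s => (τ - s) ^ (-α) • v s) volume 0 τ)
    (hderiv : HasDerivAt (fun τ => ∫ s in (0 : ℝ)..τ, (τ - s) ^ (-α) • v s)
      (Real.Gamma (1 - α) • w) (t - a)) :
    HasRegularizedCaputoDeriv α a u t w := by
  have hΓ : Real.Gamma (1 - α) ≠ 0 := (Real.Gamma_pos_of_pos (by linarith)).ne'
  have hcongr : ∀ τ, a < τ → EqOn (fun s => ((τ - a) - (s - a)) ^ (-α) • v (s - a))
      (fun s => (τ - s) ^ (-α) • (u s - u a)) (uIoo a τ) := by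
    intro τ hτ s hs
    rw [uIoo_of_le hτ.le] at hs
    simp only [huv s hs.1, sub_sub_sub_cancel_right]
  refine ⟨fun τ hτ => ?_, ?_⟩
  · have h := (hint (τ - a) (by linarith)).comp_sub_right a
    rw [zero_add, sub_add_cancel] at h
    exact h.congr_uIoo (hcongr τ hτ)
  · have h := (hderiv.comp_sub_const t a).const_smul (Real.Gamma (1 - α))⁻¹
    rw [smul_smul, inv_mul_cancel₀ hΓ, one_smul] at h
    refine h.congr_of_eventuallyEq ?_
    filter_upwards [lt_mem_nhds hat] with τ hτ
    rw [← intervalIntegral.integral_congr_uIoo (hcongr τ hτ),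
      intervalIntegral.integral_comp_sub_right (fun s => ((τ - a) - s) ^ (-α) • v s) a, sub_self]
    rfl

theorem eqOn_smul_deriv_shift (hu : ∀ s, a < s → HasDerivAt u (v' (s - a)) s) {b : ℝ} (hab : a ≤ b)
    (hbt : b ≤ t) : EqOn (fun s => ((t - a) - (s - a)) ^ (-α) • v' (s - a))
      (fun s => (t - s) ^ (-α) • deriv u s) (uIoo b t) := by
  intro s hs
  rw [uIoo_of_le hbt] at hs
  simp only [(hu s (hab.trans_lt hs.1)).deriv, sub_sub_sub_cancel_right]

theorem integral_smul_deriv_shift (hu : ∀ s, a < s → HasDerivAt u (v' (s - a)) s) {b : ℝ}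
    (hab : a ≤ b) (hbt : b ≤ t) : ∫ s in b..t, (t - s) ^ (-α) • deriv u s
      = ∫ s in (b - a)..(t - a), ((t - a) - s) ^ (-α) • v' s := by
  rw [← intervalIntegral.integral_congr_uIoo (eqOn_smul_deriv_shift hu hab hbt),
    intervalIntegral.integral_comp_sub_right (fun s => ((t - a) - s) ^ (-α) • v' s) a]

theorem hasImproperCaputoDeriv_of_shift (hα : α < 1) (hat : a < t)
    (hu : ∀ s, a < s → HasDerivAt u (v' (s - a)) s) (hv' : ContinuousOn v' (Ioi 0))
    (hlim : Tendsto (fun b => ∫ s in b..(t - a), ((t - a) - s) ^ (-α) • v' s) (𝓝[>] 0)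
      (𝓝 (Real.Gamma (1 - α) • w))) :
    HasImproperCaputoDeriv α a u t w := by
  have hΓ : Real.Gamma (1 - α) ≠ 0 := (Real.Gamma_pos_of_pos (by linarith)).ne'
  refine ⟨fun s hs => (hu s hs.1).differentiableAt, fun b hb => ?_, ?_⟩
  · have h : IntervalIntegrable (fun s => ((t - a) - s) ^ (-α) • v' s) volume (b - a) (t - a) := by
      refine (intervalIntegrable_sub_rpow_neg hα _ _ _).smul_continuousOn (hv'.mono ?_)
      rw [uIcc_of_le (by linarith [hb.2])]
      exact fun s hs => (sub_pos.2 hb.1).trans_le hs.1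
    have h' := h.comp_sub_right a
    rw [sub_add_cancel, sub_add_cancel] at h'
    exact h'.congr_uIoo (eqOn_smul_deriv_shift hu hb.1.le hb.2.le)
  · have hshift : Tendsto (fun b => b - a) (𝓝[>] a) (𝓝[>] 0) := by
      refine tendsto_nhdsWithin_iff.2 ⟨?_, ?_⟩
      · have h : Continuous fun b : ℝ => b - a := by fun_prop
        exact (h.tendsto' a 0 (sub_self a)).mono_left nhdsWithin_le_nhds
      · filter_upwards [self_mem_nhdsWithin] with b hb
        exact sub_pos.2 (mem_Ioi.1 hb)
    have h := (hlim.comp hshift).const_smul (Real.Gamma (1 - α))⁻¹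
    rw [smul_smul, inv_mul_cancel₀ hΓ, one_smul] at h
    refine h.congr' ?_
    filter_upwards [Ioo_mem_nhdsGT hat] with b hb
    rw [integral_smul_deriv_shift hu hb.1.le hb.2.le]
    rfl

theorem hasCaputoDeriv_of_shift (hα : α < 1) (hat : a < t)
    (hu : ∀ s, a < s → HasDerivAt u (v' (s - a)) s)
    (hint : IntervalIntegrable (fun s => ((t - a) - s) ^ (-α) • v' s) volume 0 (t - a))
    (heq : ∫ s in (0 : ℝ)..(t - a), ((t - a) - s) ^ (-α) • v' s = Real.Gamma (1 - α) • w) :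
    HasCaputoDeriv α a u t w := by
  have hΓ : Real.Gamma (1 - α) ≠ 0 := (Real.Gamma_pos_of_pos (by linarith)).ne'
  refine ⟨fun s hs => (hu s hs.1).differentiableAt, ?_, ?_⟩
  · have h' := hint.comp_sub_right a
    rw [zero_add, sub_add_cancel] at h'
    exact h'.congr_uIoo (eqOn_smul_deriv_shift hu le_rfl hat.le)
  · rw [caputoDeriv, integral_smul_deriv_shift hu le_rfl hat.le, sub_self, heq, smul_smul,
      inv_mul_cancel₀ hΓ, one_smul]

end Translation
end FracSectorial

open FracSectorial in
theorem lemma3p4 {X : Type*} [NormedAddCommGroup X] [NormedSpace ℂ X] [CompleteSpace X]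
    (A : X →ₗ.[ℂ] X) (M θ α μ : ℝ) (hA : FracSectorial.IsSectorial A M θ α μ)
    (hα0 : 0 < α) (hα1 : α < 1) :
    (∃ r δ : ℝ, FracSectorial.IsHankelPath θ α μ r δ) ∧
    ∀ r δ : ℝ, FracSectorial.IsHankelPath θ α μ r δ →
      ∀ (tᵢ t : ℝ), tᵢ < t → ∀ y : X,
        (∀ s, tᵢ < s → DifferentiableAt ℝ (fun s => FracSectorial.solOp A α r δ (s - tᵢ) y) s) ∧
        ∃ h : FracSectorial.solOp A α r δ (t - tᵢ) y ∈ A.domain,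
          FracSectorial.HasRegularizedCaputoDeriv α tᵢ
            (fun s => FracSectorial.solOp A α r δ (s - tᵢ) y) t
            (A ⟨FracSectorial.solOp A α r δ (t - tᵢ) y, h⟩) ∧
          (y ∈ closure (A.domain : Set X) →
            FracSectorial.HasImproperCaputoDeriv α tᵢ
              (fun s => FracSectorial.solOp A α r δ (s - tᵢ) y) t
              (A ⟨FracSectorial.solOp A α r δ (t - tᵢ) y, h⟩)) ∧
          (y ∈ A.domain →
            FracSectorial.HasCaputoDeriv α tᵢ
              (fun s => FracSectorial.solOp A α r δ (s - tᵢ) y) t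
              (A ⟨FracSectorial.solOp A α r δ (t - tᵢ) y, h⟩)) := by
  refine ⟨exists_isHankelPath hA.theta_lt hα0 hα1 μ, fun r δ hP a t hat y => ?_⟩
  have ht : 0 < t - a := sub_pos.2 hat
  have hv := hasDerivAt_orbitSub hA hP hα0 y
  have hvc := continuousOn_orbitSub hA hP hα0 y
  have hv'c := continuousOn_orbitDeriv hA hP hα0 y
  have hsol : ∀ s, a < s → solOp A α r δ (s - a) y = y + orbitSub A α r δ y (s - a) :=
    fun s hs => solOp_eq_add_symbolOp hA hP hα0 (sub_pos.2 hs) y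
  have hu : ∀ s, a < s → HasDerivAt (fun s => solOp A α r δ (s - a) y)
      (orbitDeriv A α r δ y (s - a)) s := by
    intro s hs
    refine (((hv (s - a) (sub_pos.2 hs)).comp_sub_const s a).const_add y).congr_of_eventuallyEq ?_
    filter_upwards [lt_mem_nhds hs] with x hx using hsol x hx
  have hΦ := hasDerivAt_integral_sub_rpow_smul_orbitSub hA hP hα0 hα1 y ht
  obtain ⟨h, hAS⟩ := apply_solOp hA hP hα0 ht y
  rw [← hAS] at hΦ
  have hlim : y ∈ closure (A.domain : Set X) →
      Filter.Tendsto (fun b => ∫ s in b..(t - a), ((t - a) - s) ^ (-α) • orbitDeriv A α r δ y s)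
        (𝓝[>] 0) (𝓝 (Real.Gamma (1 - α) • A ⟨solOp A α r δ (t - a) y, h⟩)) := by
    intro hy
    obtain ⟨K, -, hK⟩ := exists_norm_orbitSub_le (A := A) hA hP hα0 (2 * (t - a))
    obtain ⟨K', hK'⟩ := exists_mul_norm_orbitDeriv_le hA hP hα0 y (2 * (t - a))
    exact tendsto_integral_sub_rpow_smul_deriv hα1 ht hv hv'c (hK y) hK'
      (tendsto_orbitSub hA hP hα0 hy) hΦ
  refine ⟨fun s hs => (hu s hs).differentiableAt, h, ?_, fun hy => ?_, fun hy => ?_⟩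
  · refine hasRegularizedCaputoDeriv_of_shift (v := orbitSub A α r δ y) hα1 hat
      (fun s hs => ?_) (fun τ hτ => ?_) hΦ
    · -- the value at `tᵢ` is `S_α(0) y = y` by definition
      simp only [hsol s hs, sub_self]
      simp [solOp]
    · obtain ⟨K, -, hK⟩ := exists_norm_orbitSub_le (A := A) hA hP hα0 τ
      exact intervalIntegrable_sub_rpow_smul_of_bounded hα1 hτ hvc (hK y)
  · exact hasImproperCaputoDeriv_of_shift hα1 hat hu hv'c (hlim hy)
  · obtain ⟨K, hK⟩ := exists_norm_orbit_le_of_mem hA hP hα0 hy (t - a)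
    have hint := intervalIntegrable_sub_rpow_smul hα1 hα0 ht hv'c
      fun s hs hst => (hK s hs hst).2
    exact hasCaputoDeriv_of_shift hα1 hat hu hint
      (tendsto_nhds_unique (tendsto_integral_left hint ht) (hlim (subset_closure hy)))
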